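/- **Setting.** Let $k\ge 1$ be an integer and $\xi\in\mathbb C$. The partition algebra $P_k(\xi)$ is the $\mathbb C$-algebra with basis $\{d_\pi\}$ indexed by the set partitions $\pi$ of $\{1,\dots,2k\}$. A set partition is pictured as a diagram with bottom row $1,\dots,k$ and top row $k+1,\dots,2k$, and $d_{\pi_1}d_{\pi_2}=\xi^{[\pi_1*\pi_2]}d_{\pi_1*\pi_2}$: place $\pi_1$ above $\pi_2$, identify the bottom row of $\pi_1$ with the top row of $\pi_2$, and delete the $[\pi_1*\pi_2]$ connected components lying entirely in the middle row, which leaves $\pi_1*\pi_2$. The orbit basis $\{x_\pi\}$ is defined by $d_\pi=\sum_{\varrho}x_\varrho$, the sum being over all $\varrho$ equal to or coarser than $\pi$. Let $P_{k-\frac12}(\xi)\subseteq P_k(\xi)$ be the subalgebra spanned by the $d_\pi$ for which $k$ and $2k$ lie in the same block of $\pi$. For an integer $n\ge 1$ let $M_n=\mathbb C^n$ with standard basis $u_1,\dots,u_n$. Let $\Phi_{k,n}:P_k(n)\to \mathrm{End}(M_n^{\otimes k})$ be the algebra homomorphism given by $$\Phi_{k,n}(d_\pi)(u_{r_1}\otimes\cdots\otimes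 u_{r_k})=\sum u_{r_{k+1}}\otimes\cdots\otimes u_{r_{2k}},$$ the sum being over all $(r_{k+1},\dots,r_{2k})\in\{1,\dots,n\}^k$ such that $r_a=r_b$ whenever $a,b$ are in the same block of $\pi$. The algebra $P_{k-\frac12}(n)$ preserves $M_n^{\otimes (k-1)}\otimes u_n\cong M_n^{\otimes(k-1)}$, and $\Phi_{k-\frac12,n}:P_{k-\frac12}(n)\to\mathrm{End}(M_n^{\otimes (k-1)}\otimes u_n)$ denotes the resulting representation. For $2k>n$ let $e_{k,n}=x_{\pi_{k,n}}\in P_k(n)$, where: if $n\ge k>n/2$, then $\pi_{k,n}$ has the singleton blocks $\{i\},\{k+i\}$ for $1\le i\le n+1-k$ and the blocks $\{i,k+i\}$ for $n+1-k<i\le k$; if $k>n$, then $\pi_{k,n}$ has the blocks $\{i,k+i\}$ for $1\le i\le k$. If $2k-1>n$, then $e_{k,n}$ lies in $P_{k-\frac12}(n)$, and we put $e_{k-\frac12,n}=e_{k,n}$. **Theorem.** Let $k,n\ge1$ be integers with $2k>n$. Then $e_{k,n}$ is an essential idempotent: $e_{k,n}\neq 0$ and $(e_{k,n})^2=c_{k,n}\,e_{k,n}$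 with the nonzero scalar $$c_{k,n}=\begin{cases}(-1)^{n+1-k}\,(n+1-k)! & \text{if } n\ge k>n/2,\\ 1 & \text{if } k>n.\end{cases}$$ Moreover, $c_{k,n}^{-1}e_{k,n}$ is idempotent, and $\ker\Phi_{k,n}$ is the two-sided ideal of $P_k(n)$ generated by $c_{k,n}^{-1}e_{k,n}$. If in addition $2k-1>n$, then $\ker\Phi_{k-\frac12,n}$ is the two-sided ideal of $P_{k-\frac12}(n)$ generated by the idempotent $c_{k,n}^{-1}e_{k-\frac12,n}=c_{k,n}^{-1}e_{k,n}$. -/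

import Mathlib

noncomputable section

/-- Set partitions of the `2k` vertices of a two-row diagram: `Sum.inl i` is the `i`-th vertex of
the bottom row (the vertex `i + 1` in `{1, …, k}`) and `Sum.inr i` is the `i`-th vertex of the top
row (the vertex `k + i + 1` in `{k + 1, …, 2k}`).  A set partition is given by the equivalence
relation of lying in the same block; `π ≤ ρ` means that `π` refines `ρ`. -/
abbrev SetPartition (k : ℕ) : Type := Setoid (Fin k ⊕ Fin k)

namespace SetPartition

variable {k : ℕ}

instance : Finite (SetPartition k) :=
  Finite.of_injective (fun π : SetPartition k => fun a b => π a b)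
    (fun _ _ h => Setoid.ext fun a b => iff_of_eq (congrFun (congrFun h a) b))

instance : Fintype (SetPartition k) := Fintype.ofFinite _

/-- Vertices of two stacked diagrams are `bottom ⊕ (middle ⊕ top)`; the lower diagram occupies
the bottom and the middle row. -/
def lower : Fin k ⊕ Fin k → Fin k ⊕ (Fin k ⊕ Fin k) :=
  Sum.elim Sum.inl (fun i => Sum.inr (Sum.inl i))

/-- The upper diagram occupies the middle and the top row. -/
def upper : Fin k ⊕ Fin k → Fin k ⊕ (Fin k ⊕ Fin k) :=
  Sum.elim (fun i => Sum.inr (Sum.inl i)) (fun i => Sum.inr (Sum.inr i))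

/-- The vertices that survive: the bottom and the top row. -/
def outer : Fin k ⊕ Fin k → Fin k ⊕ (Fin k ⊕ Fin k) :=
  Sum.elim Sum.inl (fun i => Sum.inr (Sum.inr i))

/-- The partition into connected components of the three-row diagram obtained by placing `π₁`
above `π₂` and identifying the bottom row of `π₁` with the top row of `π₂`. -/
def stack (π₁ π₂ : SetPartition k) : Setoid (Fin k ⊕ (Fin k ⊕ Fin k)) :=
  π₁.map upper ⊔ π₂.map lower

/-- The concatenation `π₁ ∗ π₂` (with `π₁` above `π₂`). -/
def concat (π₁ π₂ : SetPartition k) : SetPartition k :=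
  (stack π₁ π₂).comap outer

/-- The number `[π₁ ∗ π₂]` of components that lie entirely in the middle row. -/
def removed (π₁ π₂ : SetPartition k) : ℕ :=
  Nat.card {c : Quotient (stack π₁ π₂) // ∀ v, Quotient.mk (stack π₁ π₂) (outer v) ≠ c}

/-- The partition `{1, k+1 ∣ 2, k+2 ∣ ⋯ ∣ k, 2k}`. -/
def idPartition (k : ℕ) : SetPartition k := Setoid.ker (Sum.elim id id)

/-- The partition lies in `Π_{2k-1}`: the vertices `k` and `2k` (the last vertices of the two
rows) are in the same block. -/
def LastConnected (π : SetPartition k) : Prop :=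
  ∀ i : Fin k, (i : ℕ) + 1 = k → π (Sum.inl i) (Sum.inr i)

open Classical in
/-- The matrix with entry `1` in row `r'` and column `r` if the labels `r_a` and `r_b` agree
whenever `a, b` are in the same block of `π` (the bottom row being labelled by `r` and the top row
by `r'`), and entry `0` otherwise. -/
def diagramMatrix (N : ℕ) (π : SetPartition k) :
    Matrix (Fin k → Fin N) (Fin k → Fin N) ℂ :=
  Matrix.of fun r' r => if π ≤ Setoid.ker (Sum.elim r r') then 1 else 0

theorem map_le_iff {α β : Type*} (r : Setoid α) (f : α → β) (s : Setoid β) :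
    r.map f ≤ s ↔ r ≤ s.comap f := by
  constructor
  · intro h x y hxy
    exact h (Relation.EqvGen.rel _ _ ⟨x, y, hxy, rfl, rfl⟩)
  · intro h
    refine Setoid.eqvGen_le ?_
    rintro _ _ ⟨x, y, hxy, rfl, rfl⟩
    exact h hxy

theorem stack_le_ker_iff {X : Type*} (π₁ π₂ : SetPartition k) (b m t : Fin k → X) :
    stack π₁ π₂ ≤ Setoid.ker (Sum.elim b (Sum.elim m t)) ↔
      π₁ ≤ Setoid.ker (Sum.elim m t) ∧ π₂ ≤ Setoid.ker (Sum.elim b m) := by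
  have h1 : (Setoid.ker (Sum.elim b (Sum.elim m t))).comap upper =
      Setoid.ker (Sum.elim m t) := by
    ext x y
    rcases x with x | x <;> rcases y with y | y <;> rfl
  have h2 : (Setoid.ker (Sum.elim b (Sum.elim m t))).comap lower =
      Setoid.ker (Sum.elim b m) := by
    ext x y
    rcases x with x | x <;> rcases y with y | y <;> rfl
  rw [stack, sup_le_iff, map_le_iff, map_le_iff, h1, h2]

theorem card_labelings {N : ℕ} (π₁ π₂ : SetPartition k) (b t : Fin k → Fin N)
    (h : concat π₁ π₂ ≤ Setoid.ker (Sum.elim b t)) :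
    Nat.card {m : Fin k → Fin N //
      stack π₁ π₂ ≤ Setoid.ker (Sum.elim b (Sum.elim m t))} = N ^ removed π₁ π₂ := by
  classical
  let J := stack π₁ π₂
  have helim : ∀ (m : Fin k → Fin N) (v : Fin k ⊕ Fin k),
      Sum.elim b (Sum.elim m t) (outer v) = Sum.elim b t v := by
    intro m v; rcases v with v | v <;> rfl
  let C := {c : Quotient J // ∀ v, Quotient.mk J (outer v) ≠ c}
  let G : (C → Fin N) → Quotient J → Fin N := fun f c =>
    if hc : ∃ v, Quotient.mk J (outer v) = c then Sum.elim b t hc.choose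
    else f ⟨c, fun v hv => hc ⟨v, hv⟩⟩
  have hGout : ∀ f v, G f (Quotient.mk J (outer v)) = Sum.elim b t v := by
    intro f v
    have hc : ∃ w, Quotient.mk J (outer w) = Quotient.mk J (outer v) := ⟨v, rfl⟩
    simp only [G, dif_pos hc]
    exact h (Quotient.exact (s := J) hc.choose_spec)
  have hGelim : ∀ f x, Sum.elim b (Sum.elim (fun i => G f (Quotient.mk J (Sum.inr (Sum.inl i)))) t)
      x = G f (Quotient.mk J x) := by
    intro f x
    rcases x with x | x | x
    · exact (hGout f (Sum.inl x)).symm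
    · rfl
    · exact (hGout f (Sum.inr x)).symm
  let e : {m : Fin k → Fin N // J ≤ Setoid.ker (Sum.elim b (Sum.elim m t))} ≃ (C → Fin N) :=
    { toFun := fun m c => Quotient.lift (Sum.elim b (Sum.elim m.1 t)) (fun _ _ hxy => m.2 hxy) c.1
      invFun := fun f => ⟨fun i => G f (Quotient.mk J (Sum.inr (Sum.inl i))), by
        intro x y hxy
        change Sum.elim _ _ x = Sum.elim _ _ y
        rw [hGelim, hGelim]
        exact congrArg (G f) (Quotient.sound hxy)⟩
      left_inv := by
        rintro ⟨m, hm⟩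
        refine Subtype.ext (funext fun i => ?_)
        by_cases hc : ∃ v, Quotient.mk J (outer v) = Quotient.mk J (Sum.inr (Sum.inl i))
        · have h1 := hm (Quotient.exact hc.choose_spec)
          have h2 : Sum.elim b (Sum.elim m t) (outer hc.choose) = m i := h1
          rw [helim] at h2
          simp only [G, dif_pos hc]
          exact h2
        · simp only [G, dif_neg hc]
          rfl
      right_inv := by
        intro f
        funext ⟨c, hc⟩
        induction c using Quotient.inductionOn with
        | h x =>
          change Sum.elim _ _ x = _
          rw [hGelim]
          have hn : ¬ ∃ v, Quotient.mk J (outer v) = Quotient.mk J x := by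
            rintro ⟨v, hv⟩; exact hc v hv
          simp only [G, dif_neg hn] }
  have hcard := Nat.card_congr e
  rw [Nat.card_fun] at hcard
  rw [Nat.card_eq_fintype_card (α := Fin N), Fintype.card_fin] at hcard
  exact hcard

/-- The diagram matrices multiply like diagrams with parameter `N`. -/
theorem diagramMatrix_mul (N : ℕ) (π₁ π₂ : SetPartition k) :
    diagramMatrix N π₁ * diagramMatrix N π₂ =
      ((N : ℂ) ^ removed π₁ π₂) • diagramMatrix N (concat π₁ π₂) := by
  classical
  ext t b
  have key : (diagramMatrix N π₁ * diagramMatrix N π₂) t b =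
      (Nat.card {m : Fin k → Fin N //
        stack π₁ π₂ ≤ Setoid.ker (Sum.elim b (Sum.elim m t))} : ℂ) := by
    rw [Nat.card_eq_fintype_card, Fintype.card_subtype, Matrix.mul_apply,
      ← Finset.sum_boole]
    refine Finset.sum_congr rfl fun m _ => ?_
    simp only [diagramMatrix, Matrix.of_apply, stack_le_ker_iff]
    by_cases h1 : π₁ ≤ Setoid.ker (Sum.elim m t) <;>
      by_cases h2 : π₂ ≤ Setoid.ker (Sum.elim b m) <;> simp [h1, h2]
  rw [key]
  simp only [diagramMatrix, Matrix.smul_apply, Matrix.of_apply, smul_eq_mul]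
  by_cases h : concat π₁ π₂ ≤ Setoid.ker (Sum.elim b t)
  · rw [card_labelings π₁ π₂ b t h, if_pos h]
    simp
  · rw [if_neg h, mul_zero, Nat.cast_eq_zero, Nat.card_eq_zero]
    left
    constructor
    rintro ⟨m, hm⟩
    apply h
    intro x y hxy
    have := hm hxy
    rcases x with x | x <;> rcases y with y | y <;> exact this

theorem diagramMatrix_id (N : ℕ) : diagramMatrix N (idPartition k) = 1 := by
  classical
  ext t b
  simp only [diagramMatrix, Matrix.of_apply, Matrix.one_apply]
  congr 1
  apply propext
  constructor
  · intro h
    funext i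
    have h1 : idPartition k (Sum.inr i) (Sum.inl i) := rfl
    exact h h1
  · rintro rfl x y hxy
    have h1 : Sum.elim id id x = Sum.elim id id y := hxy
    change Sum.elim t t x = Sum.elim t t y
    rcases x with x | x <;> rcases y with y | y <;> simp at h1 <;> simp [h1]

theorem diagramMatrix_ne_zero {N : ℕ} (hN : 0 < N) (π : SetPartition k) :
    diagramMatrix N π ≠ 0 := by
  intro h
  have h1 := congrFun (congrFun h (fun _ => ⟨0, hN⟩)) (fun _ => ⟨0, hN⟩)
  have h2 : π ≤ Setoid.ker (Sum.elim (fun _ : Fin k => (⟨0, hN⟩ : Fin N))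
      (fun _ : Fin k => (⟨0, hN⟩ : Fin N))) := by
    intro x y _
    change Sum.elim _ _ x = Sum.elim _ _ y
    rcases x with x | x <;> rcases y with y | y <;> rfl
  rw [diagramMatrix, Matrix.of_apply, if_pos h2] at h1
  exact one_ne_zero h1

/-- For a large number of labels, a diagram matrix determines its diagram, up to a scalar. -/
theorem le_of_smul_diagramMatrix_eq {π ρ : SetPartition k} {N : ℕ} (hN : 2 * k < N) {a b : ℂ}
    (ha : a ≠ 0) (h : a • diagramMatrix N π = b • diagramMatrix N ρ) : ρ ≤ π := by
  classical
  have hcard : Nat.card (Quotient π) ≤ N := by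
    have h1 : Nat.card (Quotient π) ≤ Nat.card (Fin k ⊕ Fin k) :=
      Nat.card_le_card_of_surjective (Quotient.mk π) Quotient.mk_surjective
    rw [Nat.card_sum, Nat.card_fin] at h1
    omega
  have : Finite (Quotient π) := Finite.of_surjective _ (Quotient.mk_surjective (s := π))
  let f : Quotient π → Fin N := fun q => Fin.castLE hcard (Finite.equivFin _ q)
  have hf : Function.Injective f := fun x y hxy => by simpa [f] using hxy
  let g : Fin k ⊕ Fin k → Fin N := fun v => f (Quotient.mk π v)
  have hg : Sum.elim (g ∘ Sum.inl) (g ∘ Sum.inr) = g := Sum.elim_comp_inl_inr g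
  have hk : Setoid.ker g = π := by
    ext x y
    exact ⟨fun hxy => Quotient.exact (hf hxy), fun hxy => congrArg f (Quotient.sound hxy)⟩
  have h1 := congrFun (congrFun h (g ∘ Sum.inr)) (g ∘ Sum.inl)
  simp only [diagramMatrix, Matrix.smul_apply, Matrix.of_apply, hg, hk, le_refl, if_true,
    smul_eq_mul, mul_one] at h1
  by_contra hne
  simp [hne] at h1
  exact ha h1

theorem eq_of_smul_diagramMatrix_eq {π ρ : SetPartition k} {a b : ℕ}
    (h : ∀ N : ℕ, ((N : ℂ) ^ a) • diagramMatrix N π = ((N : ℂ) ^ b) • diagramMatrix N ρ) :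
    a = b ∧ π = ρ := by
  have hN := h (2 * k + 2)
  have h0 : ((2 * k + 2 : ℕ) : ℂ) ≠ 0 := by exact_mod_cast (by omega : 2 * k + 2 ≠ 0)
  have h1 : π = ρ := le_antisymm
    (le_of_smul_diagramMatrix_eq (by omega) (pow_ne_zero _ h0) hN.symm)
    (le_of_smul_diagramMatrix_eq (by omega) (pow_ne_zero _ h0) hN)
  subst h1
  refine ⟨?_, rfl⟩
  have h2 := smul_left_injective ℂ (diagramMatrix_ne_zero (by omega : 0 < 2 * k + 2) π) hN
  have h3 : (2 * k + 2) ^ a = (2 * k + 2) ^ b := by exact_mod_cast h2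
  exact Nat.pow_right_injective (by omega) h3

theorem concat_assoc (π₁ π₂ π₃ : SetPartition k) :
    removed π₁ π₂ + removed (concat π₁ π₂) π₃ = removed π₂ π₃ + removed π₁ (concat π₂ π₃) ∧
      concat (concat π₁ π₂) π₃ = concat π₁ (concat π₂ π₃) := by
  refine eq_of_smul_diagramMatrix_eq fun N => ?_
  have h := mul_assoc (diagramMatrix N π₁) (diagramMatrix N π₂) (diagramMatrix N π₃)
  rw [diagramMatrix_mul, diagramMatrix_mul, Matrix.smul_mul, Matrix.mul_smul,
    diagramMatrix_mul, diagramMatrix_mul, smul_smul, smul_smul, ← pow_add, ← pow_add] at h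
  exact h

theorem id_concat (π : SetPartition k) :
    removed (idPartition k) π = 0 ∧ concat (idPartition k) π = π := by
  refine eq_of_smul_diagramMatrix_eq fun N => ?_
  rw [← diagramMatrix_mul, diagramMatrix_id, one_mul, pow_zero, one_smul]

theorem concat_id (π : SetPartition k) :
    removed π (idPartition k) = 0 ∧ concat π (idPartition k) = π := by
  refine eq_of_smul_diagramMatrix_eq fun N => ?_
  rw [← diagramMatrix_mul, diagramMatrix_id, mul_one, pow_zero, one_smul]

theorem LastConnected.concat {π₁ π₂ : SetPartition k} (h₁ : π₁.LastConnected)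
    (h₂ : π₂.LastConnected) : (concat π₁ π₂).LastConnected := by
  intro i hi
  have u : stack π₁ π₂ (Sum.inr (Sum.inl i)) (Sum.inr (Sum.inr i)) :=
    (le_sup_left : π₁.map upper ≤ stack π₁ π₂)
      (Relation.EqvGen.rel _ _ ⟨_, _, h₁ i hi, rfl, rfl⟩)
  have l : stack π₁ π₂ (Sum.inl i) (Sum.inr (Sum.inl i)) :=
    (le_sup_right : π₂.map lower ≤ stack π₁ π₂)
      (Relation.EqvGen.rel _ _ ⟨_, _, h₂ i hi, rfl, rfl⟩)
  exact (stack π₁ π₂).trans' l u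

theorem lastConnected_id : (idPartition k).LastConnected := fun _ _ => rfl

/-- The set partition `π_{k,n}`, for `2k > n`: the two vertices in each of the first `n + 1 - k`
columns are singletons (there are no such columns if `k > n`), and in each of the remaining
columns the two vertices form a block. -/
def ePartition (k n : ℕ) : SetPartition k where
  r x y := x = y ∨ ∃ i : Fin k, n + 1 ≤ (i : ℕ) + k ∧
    (x = Sum.inl i ∨ x = Sum.inr i) ∧ (y = Sum.inl i ∨ y = Sum.inr i)
  iseqv :=
    { refl := fun _ => Or.inl rfl
      symm := by
        rintro x y (rfl | ⟨i, hi, hx, hy⟩)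
        · exact Or.inl rfl
        · exact Or.inr ⟨i, hi, hy, hx⟩
      trans := by
        rintro x y z (rfl | ⟨i, hi, hx, hy⟩) (rfl | ⟨j, hj, hy', hz⟩)
        · exact Or.inl rfl
        · exact Or.inr ⟨j, hj, hy', hz⟩
        · exact Or.inr ⟨i, hi, hx, hy⟩
        · have hij : i = j := by
            rcases hy with rfl | rfl <;> simpa using hy'
          subst hij
          exact Or.inr ⟨i, hi, hx, hz⟩ }

theorem lastConnected_ePartition {n : ℕ} (h : n + 1 < 2 * k) :
    (ePartition k n).LastConnected := fun i hi =>
  Or.inr ⟨i, by omega, Or.inl rfl, Or.inr rfl⟩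

end SetPartition

open SetPartition

/-- The partition algebra `P_k(ξ)`: formal `ℂ`-linear combinations of set partitions; the product
is defined below. -/
def PartitionAlgebra (k : ℕ) (_ξ : ℂ) : Type := SetPartition k →₀ ℂ

namespace PartitionAlgebra

variable {k : ℕ} {ξ : ℂ}

instance : AddCommGroup (PartitionAlgebra k ξ) := inferInstanceAs (AddCommGroup (_ →₀ ℂ))

instance : Module ℂ (PartitionAlgebra k ξ) := inferInstanceAs (Module ℂ (_ →₀ ℂ))

/-- The diagram basis. -/
def diagramBasis (k : ℕ) (ξ : ℂ) : Module.Basis (SetPartition k) ℂ (PartitionAlgebra k ξ) :=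
  Module.Basis.ofRepr (LinearEquiv.refl ℂ (SetPartition k →₀ ℂ))

/-- The diagram basis element `d_π`. -/
def diagram (ξ : ℂ) (π : SetPartition k) : PartitionAlgebra k ξ := diagramBasis k ξ π

/-- Diagram multiplication, extended bilinearly: `d_π₁ d_π₂ = ξ ^ [π₁ ∗ π₂] d_{π₁ ∗ π₂}`. -/
def mulLin (k : ℕ) (ξ : ℂ) :
    PartitionAlgebra k ξ →ₗ[ℂ] PartitionAlgebra k ξ →ₗ[ℂ] PartitionAlgebra k ξ :=
  (diagramBasis k ξ).constr ℂ fun π₁ => (diagramBasis k ξ).constr ℂ fun π₂ =>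
    ξ ^ removed π₁ π₂ • diagram ξ (concat π₁ π₂)

instance : Mul (PartitionAlgebra k ξ) := ⟨fun a b => mulLin k ξ a b⟩

instance : One (PartitionAlgebra k ξ) := ⟨diagram ξ (idPartition k)⟩

theorem mul_def (a b : PartitionAlgebra k ξ) : a * b = mulLin k ξ a b := rfl

theorem one_def : (1 : PartitionAlgebra k ξ) = diagram ξ (idPartition k) := rfl

theorem diagram_mul_diagram (π₁ π₂ : SetPartition k) :
    diagram ξ π₁ * diagram ξ π₂ = ξ ^ removed π₁ π₂ • diagram ξ (concat π₁ π₂) := by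
  rw [mul_def, mulLin, diagram, diagram, Module.Basis.constr_basis, Module.Basis.constr_basis]

theorem mulLin_diagram (π₁ π₂ : SetPartition k) :
    mulLin k ξ (diagramBasis k ξ π₁) (diagramBasis k ξ π₂) =
      ξ ^ removed π₁ π₂ • diagramBasis k ξ (concat π₁ π₂) :=
  diagram_mul_diagram π₁ π₂

theorem mulLin_assoc (a b c : PartitionAlgebra k ξ) :
    mulLin k ξ (mulLin k ξ a b) c = mulLin k ξ a (mulLin k ξ b c) := by
  have h1 : ∀ π₁ π₂, mulLin k ξ (mulLin k ξ (diagramBasis k ξ π₁) (diagramBasis k ξ π₂)) =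
      mulLin k ξ (diagramBasis k ξ π₁) ∘ₗ mulLin k ξ (diagramBasis k ξ π₂) := by
    intro π₁ π₂
    refine (diagramBasis k ξ).ext fun π₃ => ?_
    obtain ⟨hr, hc⟩ := concat_assoc π₁ π₂ π₃
    simp only [LinearMap.comp_apply, mulLin_diagram, map_smul, LinearMap.smul_apply, smul_smul,
      ← pow_add, hr, hc]
  have h2 : ∀ π₁, mulLin k ξ ∘ₗ mulLin k ξ (diagramBasis k ξ π₁) =
      LinearMap.llcomp ℂ _ _ _ (mulLin k ξ (diagramBasis k ξ π₁)) ∘ₗ mulLin k ξ :=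
    fun π₁ => (diagramBasis k ξ).ext fun π₂ => h1 π₁ π₂
  have h3 : (mulLin k ξ).flip c ∘ₗ (mulLin k ξ).flip b =
      (mulLin k ξ).flip (mulLin k ξ b c) :=
    (diagramBasis k ξ).ext fun π₁ => LinearMap.congr_fun (LinearMap.congr_fun (h2 π₁) b) c
  exact LinearMap.congr_fun h3 a

theorem mulLin_one_left (a : PartitionAlgebra k ξ) : mulLin k ξ 1 a = a := by
  have h : mulLin k ξ 1 = LinearMap.id := (diagramBasis k ξ).ext fun π => by
    rw [one_def, diagram, mulLin_diagram, (id_concat π).1, (id_concat π).2, pow_zero, one_smul,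
      LinearMap.id_apply]
  rw [h, LinearMap.id_apply]

theorem mulLin_one_right (a : PartitionAlgebra k ξ) : mulLin k ξ a 1 = a := by
  have h : (mulLin k ξ).flip 1 = LinearMap.id := (diagramBasis k ξ).ext fun π => by
    rw [LinearMap.flip_apply, one_def, diagram, mulLin_diagram, (concat_id π).1, (concat_id π).2,
      pow_zero, one_smul, LinearMap.id_apply]
  exact LinearMap.congr_fun h a

instance : Ring (PartitionAlgebra k ξ) :=
  { (inferInstance : AddCommGroup (PartitionAlgebra k ξ)),
    (inferInstance : Mul (PartitionAlgebra k ξ)),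
    (inferInstance : One (PartitionAlgebra k ξ)) with
    left_distrib := fun a b c => map_add (mulLin k ξ a) b c
    right_distrib := fun a b c => by
      simp only [mul_def, map_add, LinearMap.add_apply]
    zero_mul := fun a => by simp only [mul_def, map_zero, LinearMap.zero_apply]
    mul_zero := fun a => map_zero (mulLin k ξ a)
    mul_assoc := mulLin_assoc
    one_mul := mulLin_one_left
    mul_one := mulLin_one_right }

instance : Algebra ℂ (PartitionAlgebra k ξ) :=
  Algebra.ofModule
    (fun r a b => by simp only [mul_def, map_smul, LinearMap.smul_apply])
    (fun r a b => map_smul (mulLin k ξ a) r b)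

open Classical in
/-- The orbit basis element `x_π`, determined by the relation `d_π = ∑_{π ⪯ ρ} x_ρ` of
`diagram_eq_sum_orbit`, that is, by `x_π = d_π - ∑_{π ≺ ρ} x_ρ`. -/
def orbit (ξ : ℂ) (π : SetPartition k) : PartitionAlgebra k ξ :=
  (wellFounded_gt (α := SetPartition k)).fix
    (fun π F => diagram ξ π - ∑ ρ : {ρ // π < ρ}, F ρ.1 ρ.2) π

open Classical in
theorem orbit_eq (π : SetPartition k) :
    orbit ξ π = diagram ξ π - ∑ ρ : {ρ // π < ρ}, orbit ξ ρ.1 :=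
  WellFounded.fix_eq _ _ _

open Classical in
theorem diagram_eq_sum_orbit (π : SetPartition k) :
    diagram ξ π = ∑ ρ with π ≤ ρ, orbit ξ ρ := by
  have h1 : (Finset.univ.filter fun ρ => π ≤ ρ) =
      insert π (Finset.univ.filter fun ρ => π < ρ) := by
    ext ρ
    simp only [Finset.mem_filter, Finset.mem_univ, true_and, Finset.mem_insert]
    rw [le_iff_eq_or_lt, eq_comm]
  rw [h1, Finset.sum_insert (by simp), orbit_eq π,
    ← Finset.sum_subtype_eq_sum_filter, Finset.subtype_univ]
  abel

/-- The subalgebra `P_{k-1/2}(ξ)` of `P_k(ξ)`: the span of the `d_π` with `k` and `2k` in the same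
block of `π`. -/
def half (k : ℕ) (ξ : ℂ) : Subalgebra ℂ (PartitionAlgebra k ξ) :=
  (Submodule.span ℂ (diagram ξ '' {π : SetPartition k | π.LastConnected})).toSubalgebra
    (Submodule.subset_span ⟨_, lastConnected_id, rfl⟩)
    (fun a b ha hb => by
      have h := Submodule.mul_mem_mul ha hb
      rw [Submodule.span_mul_span] at h
      refine Submodule.span_le.2 ?_ h
      rintro _ ⟨_, ⟨π₁, h₁, rfl⟩, _, ⟨π₂, h₂, rfl⟩, rfl⟩
      change diagram ξ π₁ * diagram ξ π₂ ∈ _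
      rw [diagram_mul_diagram]
      exact Submodule.smul_mem _ _ (Submodule.subset_span ⟨_, h₁.concat h₂, rfl⟩))

theorem diagram_mem_half {π : SetPartition k} (h : π.LastConnected) :
    diagram ξ π ∈ half k ξ :=
  Submodule.subset_span (R := ℂ) ⟨π, h, rfl⟩

theorem orbit_mem_half {π : SetPartition k} (h : π.LastConnected) : orbit ξ π ∈ half k ξ := by
  classical
  induction π using (wellFounded_gt (α := SetPartition k)).induction with
  | _ π ih =>
    rw [orbit_eq]
    refine sub_mem (diagram_mem_half h) (sum_mem fun ρ _ => ?_)
    exact ih ρ.1 ρ.2 fun i hi => ρ.2.le (h i hi)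

/-- The `k`-fold tensor power `M_n^{⊗k}` of the permutation module `M_n = ℂ^n`. -/
abbrev TensorSpace (k n : ℕ) : Type := PiTensorProduct ℂ fun _ : Fin k => (Fin n → ℂ)

/-- The basis of simple tensors `u_r = u_{r_1} ⊗ ⋯ ⊗ u_{r_k}` of `M_n^{⊗k}`, where
`u_1, …, u_n` is the standard basis of `M_n`. -/
def tensorBasis (k n : ℕ) : Module.Basis (Fin k → Fin n) ℂ (TensorSpace k n) :=
  Basis.piTensorProduct fun _ => Pi.basisFun ℂ (Fin n)

/-- The matrix of `Φ_{k,n}(a)` with respect to the basis of simple tensors. -/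
def matrixRep (k n : ℕ) :
    PartitionAlgebra k (n : ℂ) →ₐ[ℂ] Matrix (Fin k → Fin n) (Fin k → Fin n) ℂ :=
  AlgHom.ofLinearMap ((diagramBasis k (n : ℂ)).constr ℂ (diagramMatrix n))
    (by rw [one_def, diagram, Module.Basis.constr_basis, diagramMatrix_id])
    (by
      intro a b
      let F := (diagramBasis k (n : ℂ)).constr ℂ (diagramMatrix (k := k) n)
      have h1 : ∀ π₁, F ∘ₗ mulLin k n (diagramBasis k n π₁) =
          LinearMap.mulLeft ℂ (F (diagramBasis k n π₁)) ∘ₗ F := fun π₁ =>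
        (diagramBasis k (n : ℂ)).ext fun π₂ => by
          simp only [LinearMap.comp_apply, mulLin_diagram, map_smul, LinearMap.mulLeft_apply, F,
            Module.Basis.constr_basis, diagramMatrix_mul]
      have h2 : F ∘ₗ (mulLin k n).flip b = LinearMap.mulRight ℂ (F b) ∘ₗ F :=
        (diagramBasis k (n : ℂ)).ext fun π₁ => LinearMap.congr_fun (h1 π₁) b
      exact LinearMap.congr_fun h2 a)

theorem matrixRep_diagram (n : ℕ) (π : SetPartition k) :
    matrixRep k n (diagram n π) = diagramMatrix n π :=
  Module.Basis.constr_basis (diagramBasis k (n : ℂ)) ℂ (diagramMatrix n) π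

/-- The representation `Φ_{k,n} : P_k(n) → End(M_n^{⊗k})`. -/
def Phi (k n : ℕ) : PartitionAlgebra k (n : ℂ) →ₐ[ℂ] Module.End ℂ (TensorSpace k n) :=
  (Matrix.toLinAlgEquiv (tensorBasis k n)).toAlgHom.comp (matrixRep k n)

theorem Phi_apply_basis (n : ℕ) (a : PartitionAlgebra k (n : ℂ)) (r : Fin k → Fin n) :
    Phi k n a (tensorBasis k n r) = ∑ r', matrixRep k n a r' r • tensorBasis k n r' := by
  have h : Phi k n a = Matrix.toLinAlgEquiv (tensorBasis k n) (matrixRep k n a) := rfl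
  rw [h]
  generalize matrixRep k n a = M
  rw [Matrix.toLinAlgEquiv_self]

open Classical in
/-- On the orbit basis, the matrix entry of `Φ_{k,n}(x_π)` at `(r, r')` is `1` if the labels `r_a`
and `r_b` agree exactly when `a, b` are in the same block of `π`, and `0` otherwise. -/
theorem matrixRep_orbit (n : ℕ) (π : SetPartition k) (r r' : Fin k → Fin n) :
    matrixRep k n (orbit n π) r' r = if π = Setoid.ker (Sum.elim r r') then 1 else 0 := by
  induction π using (wellFounded_gt (α := SetPartition k)).induction with
  | _ π ih =>
    have h1 := congrFun (congrFun (congrArg (matrixRep k n)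
      (diagram_eq_sum_orbit (ξ := (n : ℂ)) π)) r') r
    have h2 : (Finset.univ.filter fun ρ => π ≤ ρ) =
        insert π (Finset.univ.filter fun ρ => π < ρ) := by
      ext ρ
      simp only [Finset.mem_filter, Finset.mem_univ, true_and, Finset.mem_insert]
      rw [le_iff_eq_or_lt, eq_comm]
    rw [matrixRep_diagram, h2, Finset.sum_insert (by simp), map_add, map_sum, Matrix.add_apply,
      Matrix.sum_apply, Finset.sum_congr rfl fun ρ hρ => ih ρ (Finset.mem_filter.1 hρ).2,
      Finset.sum_ite_eq', diagramMatrix, Matrix.of_apply] at h1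
    simp only [Finset.mem_filter, Finset.mem_univ, true_and] at h1
    rcases eq_or_ne π (Setoid.ker (Sum.elim r r')) with he | he
    · rw [if_pos he.le, if_neg he.not_lt, add_zero] at h1
      rw [if_pos he, h1]
    · rw [if_neg he]
      rw [le_iff_eq_or_lt] at h1
      simp only [he, false_or] at h1
      linear_combination -h1

/-- The subspace `M_n^{⊗(k-1)} ⊗ u_n` of `M_n^{⊗k}`, spanned by the simple tensors `u_r` with
`r_k = n`; it is identified with `M_n^{⊗(k-1)}`. -/
def lastFixed (k n : ℕ) : Submodule ℂ (TensorSpace k n) :=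
  Submodule.span ℂ (tensorBasis k n ''
    {r | ∀ i : Fin k, (i : ℕ) + 1 = k → (r i : ℕ) + 1 = n})

theorem Phi_mem_lastFixed {n : ℕ} {a : PartitionAlgebra k (n : ℂ)} (ha : a ∈ half k (n : ℂ)) :
    ∀ x ∈ lastFixed k n, Phi k n a x ∈ lastFixed k n := by
  intro x hx
  change a ∈ Submodule.span ℂ _ at ha
  induction ha using Submodule.span_induction with
  | zero => simp
  | add a b _ _ iha ihb => rw [map_add]; exact add_mem iha ihb
  | smul c a _ iha => rw [map_smul]; exact Submodule.smul_mem _ c iha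
  | mem a ha =>
    obtain ⟨π, hπ, rfl⟩ := ha
    induction hx using Submodule.span_induction with
    | zero => simp
    | add a b _ _ iha ihb => rw [map_add]; exact add_mem iha ihb
    | smul c a _ iha => rw [map_smul]; exact Submodule.smul_mem _ c iha
    | mem x hx =>
      obtain ⟨r, hr, rfl⟩ := hx
      have h : Phi k n (diagram n π) (tensorBasis k n r) =
          ∑ r', diagramMatrix n π r' r • tensorBasis k n r' := by
        rw [Phi_apply_basis, matrixRep_diagram]
      rw [h]
      refine sum_mem fun r' _ => ?_
      by_cases hk : π ≤ Setoid.ker (Sum.elim r r')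
      · refine Submodule.smul_mem _ _ (Submodule.subset_span ⟨r', fun i hi => ?_, rfl⟩)
        have h1 : r i = r' i := hk (hπ i hi)
        rw [← h1]
        exact hr i hi
      · rw [diagramMatrix, Matrix.of_apply, if_neg hk, zero_smul]
        exact zero_mem _

/-- The representation `Φ_{k-1/2,n} : P_{k-1/2}(n) → End(M_n^{⊗(k-1)} ⊗ u_n)`, the restriction of
`Φ_{k,n}`. -/
def PhiHalf (k n : ℕ) : half k (n : ℂ) →ₐ[ℂ] Module.End ℂ (lastFixed k n) where
  toFun a := (Phi k n a.1).restrict (Phi_mem_lastFixed a.2)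
  map_one' := by ext x; simp
  map_mul' a b := by ext x; simp
  map_zero' := by ext x; simp
  map_add' a b := by ext x; simp
  commutes' c := by ext x; simp

/-- The element `e_{k,n}` of `P_k(n)`, for `2k > n`: the orbit basis element of `π_{k,n}`. -/
def e (k n : ℕ) : PartitionAlgebra k (n : ℂ) := orbit n (ePartition k n)

/-- The element `e_{k-1/2,n} = e_{k,n}` of `P_{k-1/2}(n)`, for `2k - 1 > n`. -/
def eHalf (k n : ℕ) (h : n + 1 < 2 * k) : half k (n : ℂ) :=
  ⟨e k n, orbit_mem_half (lastConnected_ePartition h)⟩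

/-- The scalar `c_{k,n}`, for `2k > n`. -/
def c (k n : ℕ) : ℂ :=
  if k ≤ n then (-1) ^ (n + 1 - k) * ((n + 1 - k).factorial : ℂ) else 1

end PartitionAlgebra

end

/-!
The representation `Φ_{k,n}` sends the orbit basis element `x_π` to the matrix whose entry at a
labelling of the `2k` vertices is `1` if the kernel of the labelling is `π`, and `0` otherwise.  So
`ker Φ_{k,n}` is spanned by the `x_π` with more than `n` blocks.  The same holds for
`Φ_{k-1/2,n}`, because the kernel of a labelling does not change under a permutation of the labels,
by which the last vertices can be given the label `n`.

Products in `P_k(n)` are not determined by their images under `Φ_{k,n}`, but `P_k(N)` acts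
faithfully for large `N`, and the coordinates of a product are polynomials in the parameter
(`IsPolynomialFamily.eq_sum_orbit`).  Hence a product is computed by counting labellings with `N`
labels and substituting `n` for `N` in the polynomial found.  Three products are needed.

* `x_{π_{k,n}}^2` is a combination of coarsenings `δ` of `π_{k,n}`, with falling factorials of
  `N - |δ|` of length `n + 1 - k` as coefficients.  At `N = n` these vanish unless `δ = π_{k,n}`,
  where the value is `c_{k,n}` (`e_mul_self`).
* Multiplying `x_σ` on both sides by the diagrams of maps between the rows gives `x_δ`, where `δ`
  is the pullback of `σ`, times a falling factorial of `N - |δ|`, which does not vanish at `N = n`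
  if `|δ| > n` (`diagram_mul_orbit_mul_diagram`).  All partitions with more than `n` and at most
  `|π_{k,n}| = max (k, n + 1)` blocks are pullbacks of `π_{k,n}` (`exists_eq_comap_ePartition`).
* A partition `π` with more than `k` blocks has a block in the top row only.  If this block is
  merged with another one, and the resulting orbit basis element is multiplied by a diagram that
  cuts the block off, the product is `x_π` plus a sum of `x_δ` with `|δ| = |π| - 1`
  (`diagram_cutPartition_mul_orbit`).

By induction on the number of blocks, the ideal generated by `e_{k,n}` contains all `x_π` with more
than `n` blocks (`orbit_mem_of_e_mem`).  If the last column of `π` is connected, all factors can be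
chosen in `P_{k-1/2}(n)`.
-/

noncomputable section

open Polynomial

namespace SetPartition

variable {k : ℕ} {X Y : Type*}

/-! ### Blocks and labellings -/

/-- The number of blocks of a set partition. -/
def blockCount (π : Setoid X) : ℕ := Nat.card (Quotient π)

theorem natCard_range (f : X → Y) : Nat.card (Set.range f) = blockCount (Setoid.ker f) :=
  (Nat.card_congr (Setoid.quotientKerEquivRange f)).symm

theorem natCard_range_mk_comp (σ : Setoid X) (φ : Y → X) :
    Nat.card (Set.range fun y => Quotient.mk σ (φ y)) = blockCount (σ.comap φ) := by
  rw [natCard_range]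
  congr 1
  ext x y
  exact Quotient.eq (r := σ)

theorem blockCount_ker_le [Finite X] {N : ℕ} (v : X → Fin N) : blockCount (Setoid.ker v) ≤ N := by
  rw [← natCard_range]
  exact (Nat.card_le_card_of_injective (Subtype.val : Set.range v → Fin N)
    Subtype.val_injective).trans_eq (Nat.card_fin N)

theorem blockCount_le [Finite X] (π : Setoid X) : blockCount π ≤ Nat.card X :=
  Nat.card_le_card_of_surjective (Quotient.mk π) Quotient.mk_surjective

theorem exists_ker_eq [Finite X] {N : ℕ} (π : Setoid X) (h : blockCount π ≤ N) :
    ∃ v : X → Fin N, Setoid.ker v = π := by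
  let f : Quotient π → Fin N := fun q => Fin.castLE h (Finite.equivFin _ q)
  have hf : Function.Injective f := fun x y hxy =>
    (Finite.equivFin _).injective (Fin.castLE_injective h hxy)
  refine ⟨fun x => f (Quotient.mk π x), ?_⟩
  ext x y
  exact ⟨fun hxy => Quotient.exact (hf hxy), fun hxy => congrArg f (Quotient.sound hxy)⟩

theorem eq_of_le_of_blockCount_le [Finite X] {π ρ : Setoid X} (h : π ≤ ρ)
    (hc : blockCount π ≤ blockCount ρ) : π = ρ := by
  let F : Quotient π → Quotient ρ := Quotient.map id fun _ _ hab => h hab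
  have hF : Function.Surjective F := by
    intro q
    induction q using Quotient.inductionOn with
    | h x => exact ⟨Quotient.mk π x, rfl⟩
  have hb : Function.Bijective F := (Nat.bijective_iff_surjective_and_card F).2
    ⟨hF, le_antisymm hc (Nat.card_le_card_of_surjective F hF)⟩
  refine le_antisymm h fun x y hxy => ?_
  have : F (Quotient.mk π x) = F (Quotient.mk π y) := Quotient.sound hxy
  exact Quotient.exact (hb.1 this)

end SetPartition

namespace PartitionAlgebra

open SetPartition

variable {k : ℕ}

/-! ### Families that are polynomial in the parameter -/

/-- A family of elements of the algebras `P_k(ξ)`, one for each `ξ`, is polynomial if its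
coordinates in the diagram basis are polynomials in `ξ`. -/
def IsPolynomialFamily (a : ∀ ξ : ℂ, PartitionAlgebra k ξ) : Prop :=
  ∃ p : SetPartition k → ℂ[X], ∀ ξ, a ξ = ∑ π, (p π).eval ξ • diagram ξ π

theorem isPolynomialFamily_diagram (π : SetPartition k) :
    IsPolynomialFamily fun ξ => diagram ξ π := by
  classical
  exact ⟨fun ρ => if ρ = π then 1 else 0, fun ξ => by simp [apply_ite (eval ξ), ite_smul]⟩

theorem IsPolynomialFamily.sum {ι : Type*} (s : Finset ι)
    {a : ι → ∀ ξ : ℂ, PartitionAlgebra k ξ} (h : ∀ i ∈ s, IsPolynomialFamily (a i)) :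
    IsPolynomialFamily fun ξ => ∑ i ∈ s, a i ξ := by
  classical
  choose! p hp using h
  refine ⟨fun π => ∑ i ∈ s, p i π, fun ξ => ?_⟩
  simp only [eval_finsetSum, Finset.sum_smul]
  rw [Finset.sum_comm]
  exact Finset.sum_congr rfl fun i hi => hp i hi ξ

theorem IsPolynomialFamily.sub {a b : ∀ ξ : ℂ, PartitionAlgebra k ξ}
    (ha : IsPolynomialFamily a) (hb : IsPolynomialFamily b) :
    IsPolynomialFamily fun ξ => a ξ - b ξ := by
  obtain ⟨p, hp⟩ := ha
  obtain ⟨q, hq⟩ := hb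
  refine ⟨fun π => p π - q π, fun ξ => ?_⟩
  simp only [eval_sub, sub_smul, Finset.sum_sub_distrib, ← hp, ← hq]

theorem IsPolynomialFamily.smul (q : ℂ[X]) {a : ∀ ξ : ℂ, PartitionAlgebra k ξ}
    (ha : IsPolynomialFamily a) : IsPolynomialFamily fun ξ => q.eval ξ • a ξ := by
  obtain ⟨p, hp⟩ := ha
  refine ⟨fun π => q * p π, fun ξ => ?_⟩
  simp only [eval_mul, mul_smul, ← Finset.smul_sum, ← hp]

theorem IsPolynomialFamily.mul {a b : ∀ ξ : ℂ, PartitionAlgebra k ξ}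
    (ha : IsPolynomialFamily a) (hb : IsPolynomialFamily b) :
    IsPolynomialFamily fun ξ => a ξ * b ξ := by
  obtain ⟨p, hp⟩ := ha
  obtain ⟨q, hq⟩ := hb
  have h : (fun ξ => a ξ * b ξ) = fun ξ => ∑ π, ∑ ρ,
      (p π * q ρ * X ^ removed π ρ).eval ξ • diagram ξ (concat π ρ) := by
    funext ξ
    rw [hp, hq, Finset.sum_mul_sum]
    refine Finset.sum_congr rfl fun π _ => Finset.sum_congr rfl fun ρ _ => ?_
    rw [smul_mul_smul_comm, diagram_mul_diagram, smul_smul]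
    simp
  rw [h]
  exact .sum _ fun π _ => .sum _ fun ρ _ => .smul _ (isPolynomialFamily_diagram _)

theorem isPolynomialFamily_orbit (π : SetPartition k) :
    IsPolynomialFamily fun ξ => orbit ξ π := by
  classical
  induction π using (wellFounded_gt (α := SetPartition k)).induction with
  | _ π ih =>
    simp_rw [orbit_eq π]
    exact (isPolynomialFamily_diagram π).sub (.sum _ fun ρ _ => ih ρ.1 ρ.2)

theorem sum_diagram_eq_sum_orbit (ξ : ℂ) (p : SetPartition k → ℂ) :
    open Classical in
    ∑ π, p π • diagram ξ π = ∑ ρ, (∑ π with π ≤ ρ, p π) • orbit ξ ρ := by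
  classical
  simp_rw [diagram_eq_sum_orbit, Finset.smul_sum, Finset.sum_smul, Finset.sum_filter]
  rw [Finset.sum_comm]

/-- The matrix entries of `∑ c_δ x_δ` are its coordinates in the orbit basis. -/
theorem matrixRep_sum_orbit (n : ℕ) (c : SetPartition k → ℂ) (t b : Fin k → Fin n) :
    matrixRep k n (∑ δ, c δ • orbit n δ) t b = c (Setoid.ker (Sum.elim b t)) := by
  classical
  rw [map_sum, Matrix.sum_apply]
  simp only [map_smul, Matrix.smul_apply, matrixRep_orbit, smul_eq_mul, mul_ite, mul_one, mul_zero]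
  simp

/-- The coordinates of a polynomial family in the orbit basis can be read off from its images
under the representations on labellings, since these are faithful for many labels and a polynomial
is determined by its values at the large integers. -/
theorem IsPolynomialFamily.eq_sum_orbit {a : ∀ ξ : ℂ, PartitionAlgebra k ξ}
    (ha : IsPolynomialFamily a) (p : SetPartition k → ℂ[X])
    (h : ∀ (N : ℕ) (t b : Fin k → Fin N),
      matrixRep k N (a N) t b = (p (Setoid.ker (Sum.elim b t))).eval (N : ℂ)) (ξ : ℂ) :
    a ξ = ∑ δ, (p δ).eval ξ • orbit ξ δ := by
  classical
  obtain ⟨q, hq⟩ := ha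
  let r : SetPartition k → ℂ[X] := fun ρ => ∑ π with π ≤ ρ, q π
  have hr : ∀ ξ, a ξ = ∑ δ, (r δ).eval ξ • orbit ξ δ := fun ξ => by
    simp only [hq, sum_diagram_eq_sum_orbit, r, eval_finsetSum]
  have hrp : ∀ δ, r δ = p δ := by
    intro δ
    refine eq_of_infinite_eval_eq _ _ ?_
    refine Set.Infinite.mono ?_ ((Set.Ici_infinite (2 * k)).image
      (Nat.cast_injective (R := ℂ)).injOn)
    rintro _ ⟨N, hN, rfl⟩
    have hδ : blockCount δ ≤ N := by
      refine (blockCount_le δ).trans ?_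
      rw [Nat.card_sum, Nat.card_fin]
      have : 2 * k ≤ N := hN
      omega
    obtain ⟨v, rfl⟩ := exists_ker_eq δ hδ
    have h1 := h N (v ∘ Sum.inr) (v ∘ Sum.inl)
    rwa [hr, matrixRep_sum_orbit, Sum.elim_comp_inl_inr] at h1
  rw [hr]
  simp only [hrp]

/-! ### The orbit basis -/

theorem exists_eq_sum_orbit {ξ : ℂ} {Q : SetPartition k → Prop} (hQ : ∀ π ρ, π ≤ ρ → Q π → Q ρ)
    {a : PartitionAlgebra k ξ} (ha : a ∈ Submodule.span ℂ (diagram ξ '' {π | Q π})) :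
    ∃ c : SetPartition k → ℂ, (∀ δ, ¬ Q δ → c δ = 0) ∧ a = ∑ δ, c δ • orbit ξ δ := by
  classical
  induction ha using Submodule.span_induction with
  | zero => exact ⟨0, by simp, by simp⟩
  | add a b _ _ iha ihb =>
    obtain ⟨c, hc, rfl⟩ := iha
    obtain ⟨d, hd, rfl⟩ := ihb
    exact ⟨c + d, fun δ h => by simp [hc δ h, hd δ h],
      by simp [add_smul, Finset.sum_add_distrib]⟩
  | smul r a _ iha =>
    obtain ⟨c, hc, rfl⟩ := iha
    exact ⟨r • c, fun δ h => by simp [hc δ h], by simp [mul_smul, Finset.smul_sum]⟩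
  | mem a ha =>
    obtain ⟨π, hπ, rfl⟩ := ha
    refine ⟨fun δ => if π ≤ δ then 1 else 0, fun δ h => if_neg fun hle => h (hQ _ _ hle hπ), ?_⟩
    simp only [ite_smul, one_smul, zero_smul]
    rw [← Finset.sum_filter, diagram_eq_sum_orbit]

theorem span_diagram (ξ : ℂ) :
    Submodule.span ℂ (diagram ξ '' {_π : SetPartition k | True}) = ⊤ := by
  rw [Set.ofPred_true, Set.image_univ]
  exact (diagramBasis k ξ).span_eq

theorem orbit_ne_zero (ξ : ℂ) (π : SetPartition k) : orbit ξ π ≠ 0 := by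
  have hspan : ⊤ ≤ Submodule.span ℂ (Set.range (orbit (k := k) ξ)) := by
    intro a _
    obtain ⟨c, -, rfl⟩ := exists_eq_sum_orbit (Q := fun _ => True) (fun _ _ _ _ => trivial)
      (a := a) (by rw [span_diagram]; trivial)
    exact Submodule.sum_mem _ fun δ _ => Submodule.smul_mem _ _ (Submodule.subset_span ⟨δ, rfl⟩)
  exact (linearIndependent_of_top_le_span_of_card_eq_finrank hspan
    (Module.finrank_eq_card_basis (diagramBasis k ξ)).symm).ne_zero π

/-- A submodule contains the kernel of `Φ_{k,n}`, intersected with the span of an upward closed set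
of diagrams, if it contains the orbit basis elements of these diagrams with more than `n` blocks. -/
theorem mem_of_matrixRep_eq_zero {n : ℕ} {Q : SetPartition k → Prop}
    (hQ : ∀ π ρ, π ≤ ρ → Q π → Q ρ) {I : Submodule ℂ (PartitionAlgebra k (n : ℂ))}
    (hI : ∀ δ, Q δ → n < blockCount δ → orbit n δ ∈ I)
    {a : PartitionAlgebra k (n : ℂ)} (ha : a ∈ Submodule.span ℂ (diagram (n : ℂ) '' {π | Q π}))
    (h0 : matrixRep k n a = 0) : a ∈ I := by
  obtain ⟨c, hc, rfl⟩ := exists_eq_sum_orbit hQ ha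
  refine Submodule.sum_mem _ fun δ _ => ?_
  by_cases hδ : Q δ
  · by_cases hn : n < blockCount δ
    · exact Submodule.smul_mem _ _ (hI δ hδ hn)
    · obtain ⟨v, rfl⟩ := exists_ker_eq δ (not_lt.1 hn)
      have h1 := congrFun (congrFun h0 (v ∘ Sum.inr)) (v ∘ Sum.inl)
      rw [matrixRep_sum_orbit, Sum.elim_comp_inl_inr] at h1
      rw [h1, Matrix.zero_apply, zero_smul]
      exact zero_mem _
  · rw [hc δ hδ, zero_smul]
    exact zero_mem _

theorem matrixRep_orbit_eq_zero {n : ℕ} {π : SetPartition k} (h : n < blockCount π) :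
    matrixRep k n (orbit n π) = 0 := by
  ext t b
  rw [matrixRep_orbit, if_neg, Matrix.zero_apply]
  rintro rfl
  exact absurd (blockCount_ker_le (Sum.elim b t)) (not_le.2 h)

end PartitionAlgebra

namespace SetPartition

variable {k : ℕ} {X Y β : Type*}

/-! ### Counting labellings -/

/-- A map that is prescribed outside `p`, and on `p` is injective and avoids `R`, is determined by
an embedding of `p` into the complement of `R`. -/
theorem natCard_extensions [Finite X] [Finite β] (p : X → Prop) (u : {x // ¬ p x} → β)
    (R : Set β) :
    Nat.card {m : X → β // (∀ x, m x.1 = u x) ∧ (∀ x, p x → m x ∉ R) ∧ Set.InjOn m {x | p x}} =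
      (Nat.card β - Nat.card R).descFactorial (Nat.card {x // p x}) := by
  classical
  let F : {m : X → β // (∀ x, m x.1 = u x) ∧ (∀ x, p x → m x ∉ R) ∧ Set.InjOn m {x | p x}} ≃
      ({x // p x} ↪ {y // y ∉ R}) :=
    { toFun := fun m => ⟨fun x => ⟨m.1 x.1, m.2.2.1 x.1 x.2⟩, fun x y hxy =>
        Subtype.ext (m.2.2.2 x.2 y.2 (congrArg Subtype.val hxy))⟩
      invFun := fun f => ⟨fun x => if h : p x then (f ⟨x, h⟩).1 else u ⟨x, h⟩, by
        refine ⟨fun x => dif_neg x.2, fun x hx => ?_, fun x hx y hy hxy => ?_⟩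
        · simp only [dif_pos hx]
          exact (f ⟨x, hx⟩).2
        · simp only [Set.mem_ofPred_eq] at hx hy
          simp only [dif_pos hx, dif_pos hy] at hxy
          exact congrArg Subtype.val (f.injective (Subtype.ext hxy))⟩
      left_inv := by
        rintro ⟨m, h1, h2, h3⟩
        refine Subtype.ext (funext fun x => ?_)
        by_cases hx : p x
        · exact dif_pos hx
        · exact (dif_neg hx).trans (h1 ⟨x, hx⟩).symm
      right_inv := by
        intro f
        ext x
        simp [x.2] }
  have := Fintype.ofFinite X
  have := Fintype.ofFinite β
  rw [Nat.card_congr F, Nat.card_eq_fintype_card, Fintype.card_embedding_eq,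
    Nat.card_eq_fintype_card, Nat.card_eq_fintype_card, Nat.card_eq_fintype_card,
    ← Fintype.card_subtype_compl]

/-- A labelling with kernel `σ` that restricts along `φ` to `v` is an embedding of the blocks of `σ`
into the labels, prescribed by `v` on the blocks that meet the image of `φ`. -/
theorem natCard_labellings_comp [Finite X] [Finite Y] {N : ℕ} (σ : Setoid X) (φ : Y → X)
    (v : Y → Fin N) :
    open Classical in
    Nat.card {w : X → Fin N // Setoid.ker w = σ ∧ w ∘ φ = v} =
      if Setoid.ker v = σ.comap φ then
        (N - blockCount (Setoid.ker v)).descFactorial (blockCount σ - blockCount (Setoid.ker v))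
      else 0 := by
  classical
  split_ifs with h
  · let g : Y → Quotient σ := fun y => Quotient.mk σ (φ y)
    have hg : ∀ y y', g y = g y' → v y = v y' := fun y y' hy => by
      have h1 : σ.comap φ y y' := Quotient.exact (s := σ) hy
      rwa [← h] at h1
    have hg' : ∀ y y', v y = v y' → g y = g y' := fun y y' hy =>
      Quotient.sound (h ▸ (show Setoid.ker v y y' from hy) : σ.comap φ y y')
    let p : Quotient σ → Prop := fun q => q ∉ Set.range g
    let u : {q // ¬ p q} → Fin N := fun q => v (not_not.1 q.2).choose
    have hu : ∀ y (hy : ¬ p (g y)), u ⟨g y, hy⟩ = v y := fun y hy =>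
      hg _ _ (not_not.1 hy).choose_spec
    have hp : ∀ y, ¬ p (g y) := fun y => not_not.2 ⟨y, rfl⟩
    let F : {w : X → Fin N // Setoid.ker w = σ ∧ w ∘ φ = v} ≃
        {m : Quotient σ → Fin N // (∀ q, m q.1 = u q) ∧ (∀ q, p q → m q ∉ Set.range v) ∧
          Set.InjOn m {q | p q}} :=
      { toFun := fun w => ⟨Quotient.lift w.1 fun x y hxy =>
            (w.2.1.symm ▸ hxy : Setoid.ker w.1 x y), by
          obtain ⟨w, rfl, hw⟩ := w
          have hinj : Function.Injective (Quotient.lift (s := Setoid.ker w) w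
              fun x y hxy => hxy) := by
            intro q q' hq
            induction q using Quotient.inductionOn
            induction q' using Quotient.inductionOn
            exact Quotient.sound hq
          refine ⟨?_, ?_, hinj.injOn⟩
          · rintro ⟨q, hq⟩
            obtain ⟨y, rfl⟩ := not_not.1 hq
            rw [hu]
            exact congrFun hw y
          · rintro q hq ⟨y, hy⟩
            exact hq ⟨y, hinj (Eq.trans (congrFun hw y) hy)⟩⟩
        invFun := fun m => ⟨fun x => m.1 (Quotient.mk σ x), by
          obtain ⟨m, h1, h2, h3⟩ := m
          have h4 : ∀ y, m (g y) = v y := fun y => (h1 ⟨g y, hp y⟩).trans (hu y _)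
          refine ⟨?_, funext h4⟩
          have hinj : Function.Injective m := by
            intro q q' hq
            by_cases hq1 : p q <;> by_cases hq2 : p q'
            · exact h3 hq1 hq2 hq
            · obtain ⟨y, rfl⟩ := not_not.1 hq2
              exact absurd ⟨y, (hq.trans (h4 y)).symm⟩ (h2 q hq1)
            · obtain ⟨y, rfl⟩ := not_not.1 hq1
              exact absurd ⟨y, (hq.symm.trans (h4 y)).symm⟩ (h2 q' hq2)
            · obtain ⟨y, rfl⟩ := not_not.1 hq1
              obtain ⟨y', rfl⟩ := not_not.1 hq2
              rw [h4, h4] at hq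
              exact hg' _ _ hq
          ext x y
          exact ⟨fun hxy => Quotient.exact (hinj hxy), fun hxy => congrArg m (Quotient.sound hxy)⟩⟩
        left_inv := fun w => rfl
        right_inv := fun m => by
          refine Subtype.ext (funext fun q => ?_)
          induction q using Quotient.inductionOn
          rfl }
    have hcompl : Nat.card {q // p q} = blockCount σ - blockCount (Setoid.ker v) := by
      have h1 := natCard_range_mk_comp σ φ
      rw [← h] at h1
      have := Fintype.ofFinite (Quotient σ)
      rw [← h1, blockCount, Nat.card_eq_fintype_card, Nat.card_eq_fintype_card,
        Nat.card_eq_fintype_card, ← Fintype.card_subtype_compl]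
    rw [Nat.card_congr F, natCard_extensions, hcompl, natCard_range, Nat.card_fin]
  · rw [Nat.card_eq_zero]
    refine Or.inl ⟨?_⟩
    rintro ⟨w, rfl, rfl⟩
    exact h rfl

end SetPartition

namespace PartitionAlgebra

open SetPartition

variable {k : ℕ}

/-! ### Pulling back an orbit basis element -/

/-- The falling factorial `(ξ - d) (ξ - d - 1) ⋯ (ξ - d - r + 1)` as a polynomial in `ξ`. -/
def fallingFactorial (d r : ℕ) : ℂ[X] := (descPochhammer ℂ r).comp (X - C (d : ℂ))

theorem eval_fallingFactorial (d r : ℕ) (ξ : ℂ) :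
    (fallingFactorial d r).eval ξ = ∏ j ∈ Finset.range r, (ξ - d - j) := by
  rw [fallingFactorial, eval_comp, descPochhammer_eval_eq_prod_range]
  simp

theorem eval_fallingFactorial_natCast {d r N : ℕ} (h : d ≤ N) :
    (fallingFactorial d r).eval (N : ℂ) = (N - d).descFactorial r := by
  rw [fallingFactorial, eval_comp, eval_sub, eval_X, eval_C, ← Nat.cast_sub h,
    descPochhammer_eval_eq_descFactorial]

theorem eval_fallingFactorial_ne_zero {d r n : ℕ} (h : n < d) :
    (fallingFactorial d r).eval (n : ℂ) ≠ 0 := by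
  rw [eval_fallingFactorial, Finset.prod_ne_zero_iff]
  intro j _ h0
  have h1 : (n : ℂ) = ((d + j : ℕ) : ℂ) := by
    push_cast
    linear_combination h0
  have := Nat.cast_injective h1
  omega

theorem matrixRep_diagram_mul_orbit_mul_diagram (N : ℕ) (α σ β : SetPartition k)
    (t b : Fin k → Fin N) :
    matrixRep k N (diagram N α * orbit N σ * diagram N β) t b =
      Nat.card {w : Fin k ⊕ Fin k → Fin N // Setoid.ker w = σ ∧
        α ≤ Setoid.ker (Sum.elim (w ∘ Sum.inr) t) ∧
        β ≤ Setoid.ker (Sum.elim b (w ∘ Sum.inl))} := by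
  classical
  rw [Nat.card_congr ((Equiv.sumArrowEquivProdArrow _ _ _).subtypeEquiv
    (q := fun w : (Fin k → Fin N) × (Fin k → Fin N) => Setoid.ker (Sum.elim w.1 w.2) = σ ∧
        α ≤ Setoid.ker (Sum.elim w.2 t) ∧ β ≤ Setoid.ker (Sum.elim b w.1))
    (fun w => by
      have : Sum.elim (w ∘ Sum.inl) (w ∘ Sum.inr) = w := Sum.elim_comp_inl_inr w
      change _ ↔ Setoid.ker (Sum.elim (w ∘ Sum.inl) (w ∘ Sum.inr)) = σ ∧ _
      rw [this]
      rfl))]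
  rw [Nat.card_eq_fintype_card, Fintype.card_subtype, ← Finset.sum_boole, Fintype.sum_prod_type,
    map_mul, map_mul, Matrix.mul_apply]
  refine Finset.sum_congr rfl fun m' _ => ?_
  rw [Matrix.mul_apply, Finset.sum_mul]
  refine Finset.sum_congr rfl fun m _ => ?_
  rw [matrixRep_diagram, matrixRep_diagram, matrixRep_orbit, diagramMatrix, Matrix.of_apply,
    diagramMatrix, Matrix.of_apply]
  simp only [ite_and, eq_comm (a := σ)]
  split_ifs <;> simp

theorem ker_elim_id_left_le {N : ℕ} (f : Fin k → Fin k) (m t : Fin k → Fin N) :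
    (Setoid.ker (Sum.elim id f) : SetPartition k) ≤ Setoid.ker (Sum.elim m t) ↔ m ∘ f = t := by
  constructor
  · intro h
    funext j
    have h1 : (Setoid.ker (Sum.elim id f) : SetPartition k) (Sum.inl (f j)) (Sum.inr j) := rfl
    exact h h1
  · rintro rfl x y hxy
    have h1 : ∀ x, Sum.elim m (m ∘ f) x = m (Sum.elim id f x) := by
      rintro (x | x) <;> rfl
    change Sum.elim m (m ∘ f) x = Sum.elim m (m ∘ f) y
    rw [h1, h1]
    exact congrArg m hxy

theorem ker_elim_id_right_le {N : ℕ} (g : Fin k → Fin k) (b m : Fin k → Fin N) :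
    (Setoid.ker (Sum.elim g id) : SetPartition k) ≤ Setoid.ker (Sum.elim b m) ↔ m ∘ g = b := by
  constructor
  · intro h
    funext j
    have h1 : (Setoid.ker (Sum.elim g id) : SetPartition k) (Sum.inr (g j)) (Sum.inl j) := rfl
    exact h h1
  · rintro rfl x y hxy
    have h1 : ∀ x, Sum.elim (m ∘ g) m x = m (Sum.elim g id x) := by
      rintro (x | x) <;> rfl
    change Sum.elim (m ∘ g) m x = Sum.elim (m ∘ g) m y
    rw [h1, h1]
    exact congrArg m hxy

/-- Multiplying `x_σ` by the diagrams of maps `f` and `g` of the top and bottom row pulls `σ` back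
along these maps, up to a falling factorial that counts the labels of the blocks of `σ` outside
the image. -/
theorem diagram_mul_orbit_mul_diagram (ξ : ℂ) (σ : SetPartition k) (f g : Fin k → Fin k) :
    diagram ξ (Setoid.ker (Sum.elim id f)) * orbit ξ σ * diagram ξ (Setoid.ker (Sum.elim g id)) =
      (fallingFactorial (blockCount (σ.comap (Sum.map g f)))
        (blockCount σ - blockCount (σ.comap (Sum.map g f)))).eval ξ •
        orbit ξ (σ.comap (Sum.map g f)) := by
  classical
  have hpoly : IsPolynomialFamily fun ξ => diagram ξ (Setoid.ker (Sum.elim id f)) * orbit ξ σ *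
      diagram ξ (Setoid.ker (Sum.elim g id)) :=
    ((isPolynomialFamily_diagram _).mul (isPolynomialFamily_orbit σ)).mul
      (isPolynomialFamily_diagram _)
  rw [hpoly.eq_sum_orbit (fun δ => if δ = σ.comap (Sum.map g f) then
    fallingFactorial (blockCount δ) (blockCount σ - blockCount δ) else 0)]
  · simp only [apply_ite (eval ξ), eval_zero, ite_smul, zero_smul]
    rw [Finset.sum_ite_eq' Finset.univ, if_pos (Finset.mem_univ _)]
  · intro N t b
    rw [matrixRep_diagram_mul_orbit_mul_diagram]
    have hcard := natCard_labellings_comp (N := N) σ (Sum.map g f) (Sum.elim b t)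
    have hiff : ∀ w : Fin k ⊕ Fin k → Fin N,
        ((Setoid.ker (Sum.elim id f) : SetPartition k) ≤ Setoid.ker (Sum.elim (w ∘ Sum.inr) t) ∧
          (Setoid.ker (Sum.elim g id) : SetPartition k) ≤ Setoid.ker (Sum.elim b (w ∘ Sum.inl))) ↔
        w ∘ Sum.map g f = Sum.elim b t := by
      intro w
      rw [ker_elim_id_left_le, ker_elim_id_right_le]
      constructor
      · rintro ⟨rfl, rfl⟩
        funext x
        rcases x with x | x <;> rfl
      · intro h
        exact ⟨funext fun j => congrFun h (Sum.inr j), funext fun j => congrFun h (Sum.inl j)⟩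
    simp only [hiff, hcard]
    split_ifs with h
    · rw [eval_fallingFactorial_natCast (blockCount_ker_le _)]
    · simp

end PartitionAlgebra

namespace SetPartition

variable {k n : ℕ}

/-! ### The partition `π_{k,n}` -/

theorem ePartition_inl_inl {i j : Fin k} :
    ePartition k n (Sum.inl i) (Sum.inl j) ↔ i = j := by
  constructor
  · rintro (h | ⟨l, -, h | h, h' | h'⟩)
    all_goals simp_all
  · rintro rfl
    exact Or.inl rfl

theorem ePartition_inr_inr {i j : Fin k} :
    ePartition k n (Sum.inr i) (Sum.inr j) ↔ i = j := by
  constructor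
  · rintro (h | ⟨l, -, h | h, h' | h'⟩)
    all_goals simp_all
  · rintro rfl
    exact Or.inl rfl

theorem ePartition_inl_inr {i j : Fin k} :
    ePartition k n (Sum.inl i) (Sum.inr j) ↔ i = j ∧ n + 1 ≤ (i : ℕ) + k := by
  constructor
  · rintro (h | ⟨l, hl, h | h, h' | h'⟩)
    all_goals simp_all
  · rintro ⟨rfl, h⟩
    exact Or.inr ⟨i, h, Or.inl rfl, Or.inr rfl⟩

theorem ePartition_inr_inl {i j : Fin k} :
    ePartition k n (Sum.inr i) (Sum.inl j) ↔ i = j ∧ n + 1 ≤ (i : ℕ) + k := by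
  rw [show ePartition k n (Sum.inr i) (Sum.inl j) ↔ ePartition k n (Sum.inl j) (Sum.inr i) from
    ⟨fun h => (ePartition k n).symm' h, fun h => (ePartition k n).symm' h⟩, ePartition_inl_inr]
  constructor <;> rintro ⟨rfl, h⟩ <;> exact ⟨rfl, h⟩

theorem ePartition_eq_ker_iff {X : Type*} {b t : Fin k → X} :
    ePartition k n = Setoid.ker (Sum.elim b t) ↔
      (∀ i j, b i = b j ↔ i = j) ∧ (∀ i j, t i = t j ↔ i = j) ∧
        ∀ i j, b i = t j ↔ i = j ∧ n + 1 ≤ (i : ℕ) + k := by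
  constructor
  · intro h
    refine ⟨fun i j => ?_, fun i j => ?_, fun i j => ?_⟩
    · rw [← ePartition_inl_inl (n := n), h]; rfl
    · rw [← ePartition_inr_inr (n := n), h]; rfl
    · rw [← ePartition_inl_inr, h]; rfl
  · rintro ⟨h1, h2, h3⟩
    ext x y
    rcases x with i | i <;> rcases y with j | j
    · exact ePartition_inl_inl.trans (h1 i j).symm
    · exact ePartition_inl_inr.trans (h3 i j).symm
    · refine ePartition_inr_inl.trans ?_
      change _ ↔ t i = b j
      rw [eq_comm (a := t i), h3]
      constructor <;> rintro ⟨rfl, h⟩ <;> exact ⟨rfl, h⟩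
    · exact ePartition_inr_inr.trans (h2 i j).symm

theorem natCard_cutColumns (h : n < 2 * k) :
    Nat.card {i : Fin k // ¬ n + 1 ≤ (i : ℕ) + k} = n + 1 - k := by
  rw [← Nat.card_fin (n + 1 - k)]
  refine Nat.card_congr
    { toFun := fun i => ⟨i.1, by have := i.2; omega⟩
      invFun := fun j => ⟨⟨j, by have := j.2; omega⟩, by have := j.2; simp only; omega⟩
      left_inv := fun i => rfl
      right_inv := fun j => rfl }

theorem blockCount_ePartition (h : n < 2 * k) :
    blockCount (ePartition k n) = k + (n + 1 - k) := by
  let F : Fin k ⊕ {i : Fin k // ¬ n + 1 ≤ (i : ℕ) + k} → Quotient (ePartition k n) :=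
    Sum.elim (fun i => Quotient.mk _ (Sum.inl i)) (fun i => Quotient.mk _ (Sum.inr i.1))
  have hF : Function.Bijective F := by
    constructor
    · rintro (i | i) (j | j) hij
      · exact congrArg Sum.inl (ePartition_inl_inl.1 (Quotient.exact hij))
      · have h1 := ePartition_inl_inr.1 (Quotient.exact hij)
        have h2 := j.2
        rw [← h1.1] at h2
        exact absurd h1.2 h2
      · exact absurd (ePartition_inr_inl.1 (Quotient.exact hij)).2 i.2
      · exact congrArg Sum.inr (Subtype.ext (ePartition_inr_inr.1 (Quotient.exact hij)))
    · intro q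
      induction q using Quotient.inductionOn with
      | h x =>
        rcases x with i | i
        · exact ⟨Sum.inl i, rfl⟩
        · by_cases hi : n + 1 ≤ (i : ℕ) + k
          · exact ⟨Sum.inl i, Quotient.sound (ePartition_inl_inr.2 ⟨rfl, hi⟩)⟩
          · exact ⟨Sum.inr ⟨i, hi⟩, rfl⟩
  rw [blockCount, ← Nat.card_eq_of_bijective F hF, Nat.card_sum, natCard_cutColumns h,
    Nat.card_fin]

/-- The coarsenings of `π_{k,n}` in which both rows stay discrete.  These are the partitions whose
orbit basis elements can occur in the square of `x_{π_{k,n}}`. -/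
def IsRowDiscreteCoarsening (n : ℕ) (δ : SetPartition k) : Prop :=
  ePartition k n ≤ δ ∧ (∀ i j, δ (Sum.inl i) (Sum.inl j) → i = j) ∧
    ∀ i j, δ (Sum.inr i) (Sum.inr j) → i = j

theorem isRowDiscreteCoarsening_ker_iff {X : Type*} {b t : Fin k → X} :
    IsRowDiscreteCoarsening n (Setoid.ker (Sum.elim b t)) ↔
      Function.Injective b ∧ Function.Injective t ∧
        ∀ i : Fin k, n + 1 ≤ (i : ℕ) + k → b i = t i := by
  constructor
  · rintro ⟨h1, h2, h3⟩
    exact ⟨fun i j => h2 i j, fun i j => h3 i j, fun i hi => h1 (ePartition_inl_inr.2 ⟨rfl, hi⟩)⟩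
  · rintro ⟨h1, h2, h3⟩
    refine ⟨?_, fun i j h => h1 h, fun i j h => h2 h⟩
    rintro x y (rfl | ⟨i, hi, rfl | rfl, rfl | rfl⟩)
    · rfl
    · rfl
    · exact h3 i hi
    · exact (h3 i hi).symm
    · rfl

theorem isRowDiscreteCoarsening_ePartition : IsRowDiscreteCoarsening n (ePartition k n) :=
  ⟨le_rfl, fun _ _ => ePartition_inl_inl.1, fun _ _ => ePartition_inr_inr.1⟩

theorem IsRowDiscreteCoarsening.le_blockCount {δ : SetPartition k}
    (h : IsRowDiscreteCoarsening n δ) : k ≤ blockCount δ := by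
  have := Nat.card_le_card_of_injective (fun i : Fin k => Quotient.mk δ (Sum.inl i))
    fun i j hij => h.2.1 i j (Quotient.exact hij)
  simpa [blockCount] using this

/-- The middle rows that stack two copies of `π_{k,n}` between given outer rows `b` and `t`: the
labels of the through columns are prescribed, and the others are new and distinct. -/
theorem natCard_middle_ePartition {N : ℕ} (h : n < 2 * k) (b t : Fin k → Fin N) :
    open Classical in
    Nat.card {m : Fin k → Fin N // ePartition k n = Setoid.ker (Sum.elim m t) ∧
        ePartition k n = Setoid.ker (Sum.elim b m)} =
      if IsRowDiscreteCoarsening n (Setoid.ker (Sum.elim b t)) then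
        (N - blockCount (Setoid.ker (Sum.elim b t))).descFactorial (n + 1 - k)
      else 0 := by
  classical
  rw [isRowDiscreteCoarsening_ker_iff]
  split_ifs with hd
  · obtain ⟨hb, ht, hbt⟩ := hd
    have hcard := natCard_extensions (fun i : Fin k => ¬ n + 1 ≤ (i : ℕ) + k)
      (fun i => t i) (Set.range (Sum.elim b t))
    rw [natCard_cutColumns h, natCard_range, Nat.card_fin] at hcard
    rw [← hcard]
    refine Nat.card_congr (Equiv.subtypeEquivRight fun m => ?_)
    rw [ePartition_eq_ker_iff, ePartition_eq_ker_iff]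
    constructor
    · rintro ⟨⟨h1, h2, h3⟩, h4, h5, h6⟩
      refine ⟨fun i => (h3 _ _).2 ⟨rfl, not_not.1 i.2⟩, ?_, fun i _ j _ hij => (h1 i j).1 hij⟩
      rintro i hi ⟨j | j, hj⟩
      · obtain ⟨rfl, h7⟩ := (h6 j i).1 hj
        exact hi h7
      · obtain ⟨rfl, h7⟩ := (h3 i j).1 hj.symm
        exact hi h7
    · rintro ⟨h1, h2, h3⟩
      have hthrough : ∀ i : Fin k, n + 1 ≤ (i : ℕ) + k → m i = t i := fun i hi =>
        h1 ⟨i, not_not.2 hi⟩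
      have hm : Function.Injective m := by
        intro i j hij
        by_cases hi : n + 1 ≤ (i : ℕ) + k <;> by_cases hj : n + 1 ≤ (j : ℕ) + k
        · rw [hthrough i hi, hthrough j hj] at hij
          exact ht hij
        · exact absurd ⟨Sum.inr i, (hthrough i hi).symm.trans hij⟩ (h2 j hj)
        · exact absurd ⟨Sum.inr j, (hthrough j hj).symm.trans hij.symm⟩ (h2 i hi)
        · exact h3 hi hj hij
      refine ⟨⟨fun i j => hm.eq_iff, fun i j => ht.eq_iff, fun i j => ?_⟩,
        fun i j => hb.eq_iff, fun i j => hm.eq_iff, fun i j => ?_⟩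
      · by_cases hi : n + 1 ≤ (i : ℕ) + k
        · simp [hthrough i hi, ht.eq_iff, hi]
        · simp only [hi, and_false, iff_false]
          exact fun hij => h2 i hi ⟨Sum.inr j, hij.symm⟩
      · by_cases hj : n + 1 ≤ (j : ℕ) + k
        · rw [hthrough j hj, ← hbt j hj, hb.eq_iff]
          constructor
          · rintro rfl
            exact ⟨rfl, hj⟩
          · exact fun h => h.1
        · constructor
          · exact fun hij => absurd ⟨Sum.inl i, hij⟩ (h2 j hj)
          · rintro ⟨rfl, hi⟩
            exact absurd hi hj
  · rw [Nat.card_eq_zero]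
    refine Or.inl ⟨?_⟩
    rintro ⟨m, h1, h2⟩
    rw [ePartition_eq_ker_iff] at h1 h2
    refine hd ⟨fun i j hij => (h2.1 i j).1 hij, fun i j hij => (h1.2.1 i j).1 hij, fun i hi => ?_⟩
    exact ((h2.2.2 i i).2 ⟨rfl, hi⟩).trans ((h1.2.2 i i).2 ⟨rfl, hi⟩)

end SetPartition

namespace PartitionAlgebra

open SetPartition

variable {k n : ℕ}

/-! ### The square of `e_{k,n}` -/

theorem orbit_ePartition_mul_self (h : n < 2 * k) (ξ : ℂ) :
    open Classical in
    orbit ξ (ePartition k n) * orbit ξ (ePartition k n) =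
      ∑ δ, (if IsRowDiscreteCoarsening n δ then
        (fallingFactorial (blockCount δ) (n + 1 - k)).eval ξ else 0) • orbit ξ δ := by
  classical
  have hpoly := (isPolynomialFamily_orbit (ePartition k n)).mul
    (isPolynomialFamily_orbit (ePartition k n))
  rw [hpoly.eq_sum_orbit (fun δ => if IsRowDiscreteCoarsening n δ then
    fallingFactorial (blockCount δ) (n + 1 - k) else 0)]
  · simp only [apply_ite (eval ξ), eval_zero]
  · intro N t b
    have hcard := natCard_middle_ePartition h b t
    rw [Nat.card_eq_fintype_card, Fintype.card_subtype] at hcard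
    rw [map_mul, Matrix.mul_apply]
    simp only [matrixRep_orbit, ← ite_and, ite_mul, one_mul, zero_mul]
    rw [Finset.sum_boole, hcard]
    split_ifs with hd
    · rw [eval_fallingFactorial_natCast (blockCount_ker_le _)]
    · simp

theorem c_ne_zero : c k n ≠ 0 := by
  unfold c
  split_ifs
  · exact mul_ne_zero (pow_ne_zero _ (by norm_num)) (by exact_mod_cast Nat.factorial_ne_zero _)
  · exact one_ne_zero

/-- At `ξ = n` the coefficient of `x_δ` in the square vanishes for every proper coarsening `δ` of
`π_{k,n}`, because `n - |δ|` is then one of `0, …, n - k`. -/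
theorem e_mul_self (h : n < 2 * k) : e k n * e k n = c k n • e k n := by
  classical
  unfold e
  rw [orbit_ePartition_mul_self h, Finset.sum_eq_single (ePartition k n)]
  · congr 1
    rw [if_pos isRowDiscreteCoarsening_ePartition, eval_fallingFactorial, blockCount_ePartition h]
    unfold c
    split_ifs with hkn
    · have h1 : k + (n + 1 - k) = n + 1 := by omega
      rw [h1, ← Finset.prod_range_add_one_eq_factorial]
      generalize n + 1 - k = r
      have h2 : ∀ j ∈ Finset.range r, (n : ℂ) - (n + 1 : ℕ) - j = (-1) * ((j + 1 : ℕ) : ℂ) := by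
        intro j _
        push_cast
        ring
      rw [Finset.prod_congr rfl h2, Finset.prod_mul_distrib, Finset.prod_const, Finset.card_range]
      push_cast
      rfl
    · have h1 : n + 1 - k = 0 := by omega
      rw [h1, Finset.prod_range_zero]
  · intro δ _ hδ
    split_ifs with hd
    · have h1 : blockCount δ < k + (n + 1 - k) := by
        rw [← blockCount_ePartition h]
        by_contra hlt
        exact hδ (eq_of_le_of_blockCount_le hd.1 (not_lt.1 hlt)).symm
      have h2 := hd.le_blockCount
      have h3 : blockCount δ ≤ n := by omega
      rw [eval_fallingFactorial_natCast h3, Nat.descFactorial_eq_zero_iff_lt.2 (by omega)]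
      simp
    · exact zero_smul _ _
  · intro h
    exact absurd (Finset.mem_univ _) h

end PartitionAlgebra

namespace SetPartition

variable {k n : ℕ}

/-! ### Partitions with few blocks as pullbacks of `π_{k,n}` -/

theorem exists_injOn_nat {Q : Type*} (s : Finset Q) {m : ℕ} (h : s.card ≤ m) :
    ∃ u : Q → ℕ, Set.InjOn u s ∧ ∀ x ∈ s, u x < m := by
  classical
  refine ⟨fun x => if hx : x ∈ s then s.equivFin ⟨x, hx⟩ else 0, fun x hx y hy hxy => ?_,
    fun x hx => ?_⟩
  · simp only [Finset.mem_coe] at hx hy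
    simp only [dif_pos hx, dif_pos hy] at hxy
    exact congrArg Subtype.val (s.equivFin.injective (Fin.ext hxy))
  · simp only [dif_pos hx]
    exact (s.equivFin ⟨x, hx⟩).2.trans_le h

/-- A set partition with more than `n` blocks has at least `n + 1 - k` blocks in the top row only,
and as many in the bottom row only.  Sending that many of them to the singleton blocks of
`π_{k,n}`, and every other block to a through column, embeds its blocks into those of `π_{k,n}`,
compatibly with the rows.  For `k > n` there are no singleton blocks, and the truncated difference
`n + 1 - k` is `0`. -/
theorem exists_eq_comap_ePartition (h : n < 2 * k) (π : SetPartition k) (h1 : n < blockCount π)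
    (h2 : blockCount π ≤ k + (n + 1 - k)) :
    ∃ f g : Fin k → Fin k, π = (ePartition k n).comap (Sum.map g f) := by
  classical
  have := Fintype.ofFinite (Quotient π)
  rw [blockCount, Nat.card_eq_fintype_card] at h1 h2
  set α := n + 1 - k with hα
  let bot : Fin k → Quotient π := fun i => Quotient.mk π (Sum.inl i)
  let top : Fin k → Quotient π := fun i => Quotient.mk π (Sum.inr i)
  have hcompl : ∀ r : Fin k → Quotient π, α ≤ (Finset.univ.image r)ᶜ.card := by
    intro r
    have h3 : (Finset.univ.image r).card ≤ k := by
      simpa using Finset.card_image_le (s := Finset.univ) (f := r)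
    rw [Finset.card_compl]
    omega
  obtain ⟨T, hT, hTc⟩ := Finset.exists_subset_card_eq (hcompl bot)
  obtain ⟨B, hB, hBc⟩ := Finset.exists_subset_card_eq (hcompl top)
  have hbotT : ∀ i, bot i ∉ T := fun i hi => by simpa using hT hi
  have htopB : ∀ i, top i ∉ B := fun i hi => by simpa using hB hi
  have hdisj : Disjoint T B := by
    rw [Finset.disjoint_left]
    intro q hq hq'
    induction q using Quotient.inductionOn with
    | h x =>
      rcases x with i | i
      · exact hbotT i hq
      · exact htopB i hq'
  have hR : (T ∪ B)ᶜ.card ≤ k - α := by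
    rw [Finset.card_compl, Finset.card_union_of_disjoint hdisj]
    omega
  obtain ⟨uT, hTi, hTl⟩ := exists_injOn_nat T hTc.le
  obtain ⟨uB, hBi, hBl⟩ := exists_injOn_nat B hBc.le
  obtain ⟨uR, hRi, hRl⟩ := exists_injOn_nat _ hR
  have hmemR : ∀ {q}, q ∉ T → q ∉ B → q ∈ (T ∪ B)ᶜ := by
    intro q hq hq'
    simp [hq, hq']
  let F : Quotient π → ℕ := fun q => if q ∈ T then uT q else α + uR q
  let G : Quotient π → ℕ := fun q => if q ∈ B then uB q else α + uR q
  have hF : ∀ {q}, q ∈ T → F q = uT q := fun hq => if_pos hq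
  have hF' : ∀ {q}, q ∉ T → F q = α + uR q := fun hq => if_neg hq
  have hG : ∀ {q}, q ∈ B → G q = uB q := fun hq => if_pos hq
  have hG' : ∀ {q}, q ∉ B → G q = α + uR q := fun hq => if_neg hq
  have hFk : ∀ i, F (top i) < k := by
    intro i
    by_cases hi : top i ∈ T
    · have := hTl _ hi
      rw [hF hi]
      omega
    · have := hRl _ (hmemR hi (htopB i))
      rw [hF' hi]
      omega
  have hGk : ∀ i, G (bot i) < k := by
    intro i
    by_cases hi : bot i ∈ B
    · have := hBl _ hi
      rw [hG hi]
      omega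
    · have := hRl _ (hmemR (hbotT i) hi)
      rw [hG' hi]
      omega
  have htt : ∀ i j, F (top i) = F (top j) → top i = top j := by
    intro i j hij
    by_cases hi : top i ∈ T <;> by_cases hj : top j ∈ T
    · rw [hF hi, hF hj] at hij
      exact hTi hi hj hij
    · rw [hF hi, hF' hj] at hij
      have := hTl _ hi
      omega
    · rw [hF' hi, hF hj] at hij
      have := hTl _ hj
      omega
    · rw [hF' hi, hF' hj] at hij
      exact hRi (hmemR hi (htopB i)) (hmemR hj (htopB j)) (by omega)
  have hbb : ∀ i j, G (bot i) = G (bot j) → bot i = bot j := by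
    intro i j hij
    by_cases hi : bot i ∈ B <;> by_cases hj : bot j ∈ B
    · rw [hG hi, hG hj] at hij
      exact hBi hi hj hij
    · rw [hG hi, hG' hj] at hij
      have := hBl _ hi
      omega
    · rw [hG' hi, hG hj] at hij
      have := hBl _ hj
      omega
    · rw [hG' hi, hG' hj] at hij
      exact hRi (hmemR (hbotT i) hi) (hmemR (hbotT j) hj) (by omega)
  have hbt : ∀ i j, bot i = top j ↔ G (bot i) = F (top j) ∧ α ≤ G (bot i) := by
    intro i j
    constructor
    · intro hij
      rw [hF' (hij ▸ hbotT i), hG' (hij ▸ htopB j), hij]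
      exact ⟨rfl, Nat.le_add_right _ _⟩
    · rintro ⟨hij, hle⟩
      have hi : bot i ∉ B := fun hi => by
        have := hBl _ hi
        rw [hG hi] at hle
        omega
      have hj : top j ∉ T := fun hj => by
        have := hTl _ hj
        rw [hij, hF hj] at hle
        omega
      rw [hG' hi, hF' hj] at hij
      exact hRi (hmemR (hbotT i) hi) (hmemR hj (htopB j)) (by omega)
  let f : Fin k → Fin k := fun i => ⟨F (top i), hFk i⟩
  let g : Fin k → Fin k := fun i => ⟨G (bot i), hGk i⟩
  have hbt' : ∀ i j, bot i = top j ↔ g i = f j ∧ n + 1 ≤ (g i : ℕ) + k := by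
    intro i j
    rw [hbt, Fin.ext_iff]
    change _ ↔ _ ∧ n + 1 ≤ G (bot i) + k
    rw [hα, Nat.sub_le_iff_le_add]
  refine ⟨f, g, Setoid.ext fun x y => ?_⟩
  rw [← Quotient.eq (r := π)]
  rcases x with i | i <;> rcases y with j | j
  · refine Iff.trans ?_ ePartition_inl_inl.symm
    exact ⟨fun hij => Fin.ext (congrArg G hij), fun hij => hbb i j (congrArg Fin.val hij)⟩
  · exact (hbt' i j).trans ePartition_inl_inr.symm
  · refine Iff.trans ?_ ePartition_inr_inl.symm
    rw [eq_comm]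
    refine (hbt' j i).trans ?_
    constructor
    · rintro ⟨hij, hle⟩
      exact ⟨hij.symm, hij ▸ hle⟩
    · rintro ⟨hij, hle⟩
      exact ⟨hij.symm, hij ▸ hle⟩
  · refine Iff.trans ?_ ePartition_inr_inr.symm
    exact ⟨fun hij => Fin.ext (congrArg F hij), fun hij => htt i j (congrArg Fin.val hij)⟩

/-- If the last column is connected in the pullback, the two maps may be chosen to fix the last
column, since `π_{k,n}` is invariant under permutations of its through columns. -/
theorem exists_eq_comap_ePartition_fixing_last (h : n + 1 < 2 * k) {π : SetPartition k}
    (hπ : π.LastConnected) {f g : Fin k → Fin k} (hfg : π = (ePartition k n).comap (Sum.map g f)) :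
    ∃ f' g' : Fin k → Fin k, π = (ePartition k n).comap (Sum.map g' f') ∧
      ∀ i : Fin k, (i : ℕ) + 1 = k → f' i = i ∧ g' i = i := by
  let l : Fin k := ⟨k - 1, by omega⟩
  have hl : ∀ i : Fin k, (i : ℕ) + 1 = k → i = l := fun i hi => Fin.ext (by simp only [l]; omega)
  have h1 : π (Sum.inl l) (Sum.inr l) := hπ l (by simp only [l]; omega)
  rw [hfg] at h1
  obtain ⟨h2, h3⟩ := ePartition_inl_inr.1 h1
  let s := Equiv.swap (f l) l
  have hs : (ePartition k n).comap (Sum.map s s) = ePartition k n := by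
    have hle : ∀ i : Fin k, n + 1 ≤ (s i : ℕ) + k ↔ n + 1 ≤ (i : ℕ) + k := by
      intro i
      have h4 : n + 1 ≤ (l : ℕ) + k := by simp only [l]; omega
      rw [h2] at h3
      rcases eq_or_ne i (f l) with rfl | hi
      · simp only [s, Equiv.swap_apply_left, h3, h4]
      · rcases eq_or_ne i l with rfl | hi'
        · simp only [s, Equiv.swap_apply_right, h3, h4]
        · simp only [s, Equiv.swap_apply_of_ne_of_ne hi hi']
    ext x y
    rcases x with i | i <;> rcases y with j | j
    · exact ePartition_inl_inl.trans (s.injective.eq_iff.trans ePartition_inl_inl.symm)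
    · refine ePartition_inl_inr.trans (Iff.trans ?_ ePartition_inl_inr.symm)
      rw [s.injective.eq_iff, hle]
    · refine ePartition_inr_inl.trans (Iff.trans ?_ ePartition_inr_inl.symm)
      rw [s.injective.eq_iff, hle]
    · exact ePartition_inr_inr.trans (s.injective.eq_iff.trans ePartition_inr_inr.symm)
  refine ⟨s ∘ f, s ∘ g, ?_, fun i hi => ?_⟩
  · rw [hfg]
    nth_rewrite 1 [← hs]
    ext x y
    rcases x with i | i <;> rcases y with j | j <;> rfl
  · obtain rfl := hl i hi
    refine ⟨Equiv.swap_apply_left _ _, ?_⟩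
    change Equiv.swap _ _ (g l) = l
    rw [show g l = f l from h2, Equiv.swap_apply_left]

/-! ### Moving a block -/

/-- `δ` agrees with `π` outside `S`, and `S` lies in one block of `δ`. -/
def AgreesOff {X : Type*} (π : Setoid X) (S : Set X) (δ : Setoid X) : Prop :=
  (∀ x ∉ S, ∀ y ∉ S, (δ x y ↔ π x y)) ∧ ∀ x ∈ S, ∀ y ∈ S, δ x y

open Classical in
/-- The map that sends every point of `S` to `d` and fixes the other points.  If `S` is a block of
`π` and `d ∉ S`, pulling `π` back along this map merges `S` with the block of `d`. -/
def collapse {X : Type*} (S : Set X) (d x : X) : X := if x ∈ S then d else x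

theorem collapse_of_mem {X : Type*} {S : Set X} {d x : X} (h : x ∈ S) : collapse S d x = d :=
  if_pos h

theorem collapse_of_notMem {X : Type*} {S : Set X} {d x : X} (h : x ∉ S) : collapse S d x = x :=
  if_neg h

theorem collapse_notMem {X : Type*} {S : Set X} {d : X} (hd : d ∉ S) (x : X) :
    collapse S d x ∉ S := by
  by_cases h : x ∈ S
  · rwa [collapse_of_mem h]
  · rwa [collapse_of_notMem h]

theorem agreesOff_comap_collapse {X : Type*} (π : Setoid X) (S : Set X) (d : X) :
    AgreesOff π S (π.comap (collapse S d)) := by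
  refine ⟨fun x hx y hy => ?_, fun x hx y hy => ?_⟩
  · rw [Setoid.comap_rel, collapse_of_notMem hx, collapse_of_notMem hy]
  · rw [Setoid.comap_rel, collapse_of_mem hx, collapse_of_mem hy]

theorem agreesOff_self {X : Type*} (π : Setoid X) (a : X) : AgreesOff π {x | π x a} π :=
  ⟨fun _ _ _ _ => Iff.rfl, fun _ hx _ hy => π.trans' hx (π.symm' hy)⟩

/-- A set partition that agrees with `π` off a block of `π` either is `π`, or attaches this block
to another one. -/
theorem AgreesOff.blockCount_add_one {X : Type*} [Finite X] {π δ : Setoid X} {a : X}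
    (h : AgreesOff π {x | π x a} δ) (hne : δ ≠ π) : blockCount δ + 1 = blockCount π := by
  set S : Set X := {x | π x a} with hS
  have haS : a ∈ S := π.refl' a
  obtain ⟨z, hz, hza⟩ : ∃ z ∉ S, δ z a := by
    by_contra! hcon
    refine hne (Setoid.ext fun x y => ?_)
    by_cases hx : x ∈ S <;> by_cases hy : y ∈ S
    · exact ⟨fun _ => π.trans' hx (π.symm' hy), fun _ => h.2 x hx y hy⟩
    · exact ⟨fun hxy => absurd (δ.trans' (δ.symm' hxy) (h.2 x hx a haS)) (hcon y hy),
        fun hxy => absurd (π.trans' (π.symm' hxy) hx) hy⟩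
    · exact ⟨fun hxy => absurd (δ.trans' hxy (h.2 y hy a haS)) (hcon x hx),
        fun hxy => absurd (π.trans' hxy hy) hx⟩
    · exact h.1 x hx y hy
  let φ : {x // x ∉ S} → X := Subtype.val
  have hcomap : δ.comap φ = π.comap φ := Setoid.ext fun x y => h.1 x x.2 y y.2
  have hδ : (Set.range fun x => Quotient.mk δ (φ x)) = Set.univ := by
    rw [Set.eq_univ_iff_forall]
    intro q
    induction q using Quotient.inductionOn with
    | h x =>
      by_cases hx : x ∈ S
      · exact ⟨⟨z, hz⟩, Quotient.sound (δ.trans' hza (h.2 a haS x hx))⟩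
      · exact ⟨⟨x, hx⟩, rfl⟩
  have hπ : (Set.range fun x => Quotient.mk π (φ x)) = {Quotient.mk π a}ᶜ := by
    ext q
    induction q using Quotient.inductionOn with
    | h x =>
      rw [Set.mem_compl_iff, Set.mem_singleton_iff, Quotient.eq]
      constructor
      · rintro ⟨y, hy⟩ hx
        exact y.2 (π.trans' (Quotient.exact hy) hx)
      · exact fun hx => ⟨⟨x, hx⟩, rfl⟩
  have h1 := natCard_range_mk_comp δ φ
  have h2 := natCard_range_mk_comp π φ
  rw [hcomap, ← h2, hδ, hπ, Nat.card_univ, Nat.card_coe_set_eq] at h1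
  have h3 := Set.ncard_add_ncard_compl {Quotient.mk π a}
  rw [Set.ncard_singleton] at h3
  rw [blockCount, blockCount, h1, ← h3, add_comm]

open Classical in
/-- The diagram that is the identity outside the columns in `C`, and whose other blocks are the two
rows of `C`. -/
def cutPartition (C : Set (Fin k)) : SetPartition k :=
  Setoid.ker (Sum.elim (fun i => if i ∈ C then Sum.inr false else Sum.inl i)
    (fun i => if i ∈ C then Sum.inr true else Sum.inl i) : Fin k ⊕ Fin k → Fin k ⊕ Bool)

theorem cutPartition_le_ker_iff {X : Type*} (C : Set (Fin k)) (m t : Fin k → X) :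
    cutPartition C ≤ Setoid.ker (Sum.elim m t) ↔ (∀ i ∉ C, m i = t i) ∧
      (∀ i ∈ C, ∀ j ∈ C, m i = m j) ∧ ∀ i ∈ C, ∀ j ∈ C, t i = t j := by
  classical
  constructor
  · intro h
    refine ⟨fun i hi => ?_, fun i hi j hj => ?_, fun i hi j hj => ?_⟩
    · have h1 : cutPartition C (Sum.inl i) (Sum.inr i) := by
        rw [cutPartition, Setoid.ker_def]
        simp [hi]
      exact h h1
    · have h1 : cutPartition C (Sum.inl i) (Sum.inl j) := by
        rw [cutPartition, Setoid.ker_def]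
        simp [hi, hj]
      exact h h1
    · have h1 : cutPartition C (Sum.inr i) (Sum.inr j) := by
        rw [cutPartition, Setoid.ker_def]
        simp [hi, hj]
      exact h h1
  · rintro ⟨h1, h2, h3⟩ x y hxy
    change Sum.elim m t x = Sum.elim m t y
    rw [cutPartition, Setoid.ker_def] at hxy
    rcases x with i | i <;> rcases y with j | j <;> by_cases hi : i ∈ C <;>
      by_cases hj : j ∈ C <;> simp [hi, hj] at hxy ⊢
    · exact h2 i hi j hj
    · rw [hxy]
    · rw [hxy, h1 j hj]
    · rw [hxy, h1 j hj]
    · exact h3 i hi j hj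
    · rw [hxy]

end SetPartition

namespace PartitionAlgebra

open SetPartition

variable {k n : ℕ}

/-- Cutting a set `S` of vertices of the top row in the orbit basis element of the partition in
which `S` is merged with the block of a bottom vertex `d`.  The label of `S` in the middle row is
that of `d`, and the label of `S` in the top row is free. -/
theorem diagram_cutPartition_mul_orbit (ξ : ℂ) (π : SetPartition k) {S : Set (Fin k ⊕ Fin k)}
    (hS : ∀ i, Sum.inl i ∉ S) (d : Fin k) :
    open Classical in
    diagram ξ (cutPartition {i | Sum.inr i ∈ S}) * orbit ξ (π.comap (collapse S (Sum.inl d))) =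
      ∑ δ with AgreesOff π S δ, orbit ξ δ := by
  classical
  have hpoly := (isPolynomialFamily_diagram (cutPartition {i : Fin k | Sum.inr i ∈ S})).mul
    (isPolynomialFamily_orbit (π.comap (collapse S (Sum.inl d))))
  rw [hpoly.eq_sum_orbit (fun δ => if AgreesOff π S δ then 1 else 0)]
  · simp only [apply_ite (eval ξ), eval_zero, eval_one, ite_smul, one_smul, zero_smul]
    rw [Finset.sum_filter]
  · intro N t b
    let m₀ : Fin k → Fin N := fun j => if Sum.inr j ∈ S then b d else t j
    have key : ∀ m : Fin k → Fin N,
        (cutPartition {i : Fin k | Sum.inr i ∈ S} ≤ Setoid.ker (Sum.elim m t) ∧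
          π.comap (collapse S (Sum.inl d)) = Setoid.ker (Sum.elim b m)) ↔
        m = m₀ ∧ AgreesOff π S (Setoid.ker (Sum.elim b t)) := by
      intro m
      rw [cutPartition_le_ker_iff]
      constructor
      · rintro ⟨⟨h1, -, h3⟩, h4⟩
        have h5 : ∀ x y, π (collapse S (Sum.inl d) x) (collapse S (Sum.inl d) y) ↔
            Sum.elim b m x = Sum.elim b m y := fun x y => by
          rw [← Setoid.comap_rel, h4, Setoid.ker_def]
        have h6 : ∀ x ∉ S, Sum.elim b m x = Sum.elim b t x := by
          rintro (x | x) hx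
          · rfl
          · exact h1 x hx
        refine ⟨funext fun j => ?_, fun x hx y hy => ?_, ?_⟩
        · by_cases hj : Sum.inr j ∈ S
          · simp only [m₀, if_pos hj]
            refine (h5 (Sum.inr j) (Sum.inl d)).1 ?_
            rw [collapse_of_mem hj, collapse_of_notMem (hS d)]
          · simp only [m₀, if_neg hj]
            exact h1 j hj
        · rw [Setoid.ker_def, ← h6 x hx, ← h6 y hy, ← h5, collapse_of_notMem hx,
            collapse_of_notMem hy]
        · rintro (x | x) hx (y | y) hy
          · exact absurd hx (hS x)
          · exact absurd hx (hS x)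
          · exact absurd hy (hS y)
          · exact h3 x hx y hy
      · rintro ⟨rfl, h1, h2⟩
        refine ⟨⟨fun i hi => if_neg hi, fun i hi j hj => ?_, fun i hi j hj => h2 _ hi _ hj⟩, ?_⟩
        · simp only [Set.mem_ofPred_eq] at hi hj
          simp only [m₀, if_pos hi, if_pos hj]
        · have h3 : ∀ x, Sum.elim b m₀ x = Sum.elim b t (collapse S (Sum.inl d) x) := by
            rintro (x | x)
            · rw [collapse_of_notMem (hS x)]
              rfl
            · by_cases hx : Sum.inr x ∈ S
              · rw [collapse_of_mem hx]
                exact if_pos hx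
              · rw [collapse_of_notMem hx]
                exact if_neg hx
          ext x y
          rw [Setoid.comap_rel, Setoid.ker_def, h3, h3]
          exact (h1 _ (collapse_notMem (hS d) x) _ (collapse_notMem (hS d) y)).symm
    rw [map_mul, Matrix.mul_apply, matrixRep_diagram]
    simp only [matrixRep_orbit, diagramMatrix, Matrix.of_apply, ← ite_and, ite_mul, one_mul,
      zero_mul, key]
    simp only [ite_and]
    rw [Finset.sum_ite_eq' Finset.univ, if_pos (Finset.mem_univ _)]
    split_ifs <;> simp

/-! ### The ideal generated by `e_{k,n}` -/

/-- A submodule that contains `e_{k,n}` and is stable under multiplication by diagrams contains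
every `x_π` with more than `n` blocks.  The proposition `L` says whether all diagrams involved are
required to connect the last column, so that both `P_k` and `P_{k-1/2}` are covered. -/
theorem orbit_mem_of_e_mem (h : n < 2 * k) {L : Prop} (hL : L → n + 1 < 2 * k)
    {I : Submodule ℂ (PartitionAlgebra k (n : ℂ))} (he : e k n ∈ I)
    (hleft : ∀ α : SetPartition k, (L → α.LastConnected) → ∀ x ∈ I, diagram (n : ℂ) α * x ∈ I)
    (hright : ∀ α : SetPartition k, (L → α.LastConnected) → ∀ x ∈ I, x * diagram (n : ℂ) α ∈ I)
    (π : SetPartition k) (hπ : L → π.LastConnected) (hn : n < blockCount π) :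
    orbit (n : ℂ) π ∈ I := by
  classical
  induction hB : blockCount π using Nat.strong_induction_on generalizing π with
  | _ B ih =>
  subst hB
  by_cases hsmall : blockCount π ≤ k + (n + 1 - k)
  · obtain ⟨f, g, hfg, hlast⟩ : ∃ f g : Fin k → Fin k,
        π = (ePartition k n).comap (Sum.map g f) ∧
          (L → ∀ i : Fin k, (i : ℕ) + 1 = k → f i = i ∧ g i = i) := by
      obtain ⟨f, g, hfg⟩ := exists_eq_comap_ePartition h π hn hsmall
      by_cases hl : L
      · obtain ⟨f', g', h1, h2⟩ := exists_eq_comap_ePartition_fixing_last (hL hl) (hπ hl) hfg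
        exact ⟨f', g', h1, fun _ => h2⟩
      · exact ⟨f, g, hfg, fun hl' => absurd hl' hl⟩
    have h1 := diagram_mul_orbit_mul_diagram (n : ℂ) (ePartition k n) f g
    rw [← hfg] at h1
    have h2 : diagram (n : ℂ) (Setoid.ker (Sum.elim id f)) * e k n *
        diagram (n : ℂ) (Setoid.ker (Sum.elim g id)) ∈ I :=
      hright (Setoid.ker (Sum.elim g id)) (fun hl i hi => (hlast hl i hi).2) _
        (hleft (Setoid.ker (Sum.elim id f)) (fun hl i hi => (hlast hl i hi).1.symm) _ he)
    rw [e, h1] at h2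
    -- The scalar does not vanish, although the falling factorial has possibly several factors,
    -- because `n - |π|` is negative.
    exact (Submodule.smul_mem_iff _ (eval_fallingFactorial_ne_zero hn)).1 h2
  · -- There are more than `k` blocks, so some block misses the bottom row.
    obtain ⟨a, ha⟩ : ∃ a, ∀ i : Fin k, ¬ π (Sum.inl i) a := by
      by_contra! hcon
      have hsurj : Function.Surjective fun i : Fin k => Quotient.mk π (Sum.inl i) := by
        intro q
        induction q using Quotient.inductionOn with
        | h x =>
          obtain ⟨i, hi⟩ := hcon x
          exact ⟨i, Quotient.sound hi⟩
      have := Nat.card_le_card_of_surjective _ hsurj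
      rw [Nat.card_fin] at this
      exact hsmall (this.trans (Nat.le_add_right _ _))
    let d : Fin k := ⟨0, by omega⟩
    set S : Set (Fin k ⊕ Fin k) := {x | π x a}
    -- Such `δ` have `|π| - 1 ≥ max (k, n + 1) > n` blocks, so the induction hypothesis applies.
    have hlow : ∀ δ, AgreesOff π S δ → δ ≠ π → orbit (n : ℂ) δ ∈ I := by
      intro δ hδ hne
      have hcard := hδ.blockCount_add_one hne
      refine ih (blockCount δ) (by omega) δ (fun hl i hi => ?_) (by omega) rfl
      have h1 := hπ hl i hi
      exact (hδ.1 _ (ha i) _ fun h2 => ha i (π.trans' h1 h2)).2 h1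
    have hσ : orbit (n : ℂ) (π.comap (collapse S (Sum.inl d))) ∈ I := by
      refine hlow _ (agreesOff_comap_collapse π S _) fun heq => ha d ?_
      rw [← heq, Setoid.comap_rel, collapse_of_notMem (S := S) (ha d),
        collapse_of_mem (S := S) (π.refl' a)]
    have hcut : L → (cutPartition {i : Fin k | Sum.inr i ∈ S}).LastConnected := by
      intro hl i hi
      have h1 := hπ hl i hi
      have h2 : i ∉ {i : Fin k | Sum.inr i ∈ S} := fun h2 => ha i (π.trans' h1 h2)
      rw [cutPartition, Setoid.ker_def]
      simp only [Sum.elim_inl, Sum.elim_inr, if_neg h2]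
    have hprod := hleft _ hcut _ hσ
    rw [diagram_cutPartition_mul_orbit _ _ ha,
      ← Finset.add_sum_erase _ _ (Finset.mem_filter.2 ⟨Finset.mem_univ π, agreesOff_self π a⟩)]
      at hprod
    refine (Submodule.add_mem_iff_left I (Submodule.sum_mem _ fun δ hδ => ?_)).1 hprod
    rw [Finset.mem_erase, Finset.mem_filter] at hδ
    exact hlow δ hδ.2.2 hδ.1

theorem matrixRep_e (h : n < 2 * k) : matrixRep k n (e k n) = 0 := by
  refine matrixRep_orbit_eq_zero ?_
  rw [blockCount_ePartition h]
  omega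

theorem Phi_eq_zero_iff {a : PartitionAlgebra k (n : ℂ)} :
    Phi k n a = 0 ↔ matrixRep k n a = 0 :=
  map_eq_zero_iff (Matrix.toLinAlgEquiv (tensorBasis k n)) (AlgEquiv.injective _)

/-- The orbit basis coordinates, and hence all matrix entries, are already visible on the labellings
that give the last vertex the last label: permuting the labels does not change a kernel. -/
theorem PhiHalf_eq_zero_iff (hk : 1 ≤ k) (hn : 1 ≤ n) {a : half k (n : ℂ)} :
    PhiHalf k n a = 0 ↔ matrixRep k n a.1 = 0 := by
  constructor
  · intro h0
    have h1 : ∀ r r' : Fin k → Fin n, (∀ i : Fin k, (i : ℕ) + 1 = k → (r i : ℕ) + 1 = n) →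
        matrixRep k n a.1 r' r = 0 := by
      intro r r' hr
      have h2 : Phi k n a.1 (tensorBasis k n r) = 0 := by
        have h3 := LinearMap.congr_fun h0 ⟨tensorBasis k n r, Submodule.subset_span ⟨r, hr, rfl⟩⟩
        exact congrArg Subtype.val h3
      rw [Phi_apply_basis] at h2
      exact Fintype.linearIndependent_iff.1 (tensorBasis k n).linearIndependent _ h2 r'
    obtain ⟨c, -, hc⟩ := exists_eq_sum_orbit (Q := fun _ => True) (fun _ _ _ _ => trivial)
      (a := a.1) (by rw [span_diagram]; trivial)
    ext t b
    let s : Equiv.Perm (Fin n) := Equiv.swap (b ⟨k - 1, by omega⟩) ⟨n - 1, by omega⟩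
    have h2 := h1 (s ∘ b) (s ∘ t) fun i hi => by
      have hi' : i = ⟨k - 1, by omega⟩ := Fin.ext (by simp only; omega)
      rw [hi', Function.comp_apply, Equiv.swap_apply_left]
      simp only
      omega
    have hker : Setoid.ker (Sum.elim (s ∘ b) (s ∘ t)) = Setoid.ker (Sum.elim b t) := by
      rw [← Sum.comp_elim]
      ext x y
      exact s.injective.eq_iff
    rw [hc, matrixRep_sum_orbit, hker] at h2
    rw [hc, matrixRep_sum_orbit, h2, Matrix.zero_apply]
  · intro h0
    ext x
    change (Phi k n a.1) x.1 = 0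
    rw [Phi_eq_zero_iff.2 h0, LinearMap.zero_apply]

theorem isIdempotentElem_inv_smul {A : Type*} [Ring A] [Algebra ℂ A] {x : A} {r : ℂ} (hr : r ≠ 0)
    (h : x * x = r • x) : IsIdempotentElem (r⁻¹ • x) := by
  rw [IsIdempotentElem, smul_mul_smul_comm, h, smul_smul, mul_assoc, inv_mul_cancel₀ hr, mul_one]

theorem mem_span_inv_smul {A : Type*} [Ring A] [Algebra ℂ A] (x : A) {r : ℂ} (hr : r ≠ 0) :
    x ∈ TwoSidedIdeal.span {r⁻¹ • x} := by
  have h := TwoSidedIdeal.mul_mem_left _ (algebraMap ℂ A r) _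
    (TwoSidedIdeal.subset_span (Set.mem_singleton (r⁻¹ • x)))
  rwa [← Algebra.smul_def, smul_inv_smul₀ hr] at h

theorem ker_Phi (h : n < 2 * k) :
    TwoSidedIdeal.ker (Phi k n) = TwoSidedIdeal.span {(c k n)⁻¹ • e k n} := by
  refine le_antisymm (fun a ha => ?_) (TwoSidedIdeal.span_le.2 ?_)
  · rw [TwoSidedIdeal.mem_ker, Phi_eq_zero_iff] at ha
    let J := TwoSidedIdeal.span {(c k n)⁻¹ • e k n}
    have hJ := orbit_mem_of_e_mem h (L := False) False.elim
      (I := (TwoSidedIdeal.asIdeal J).restrictScalars ℂ) (mem_span_inv_smul _ c_ne_zero)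
      (fun α _ x hx => J.mul_mem_left _ _ hx) (fun α _ x hx => J.mul_mem_right _ _ hx)
    exact mem_of_matrixRep_eq_zero (Q := fun _ => True) (fun _ _ _ _ => trivial)
      (fun δ _ hδ => hJ δ False.elim hδ) (by rw [span_diagram]; trivial) ha
  · rw [Set.singleton_subset_iff]
    change _ ∈ TwoSidedIdeal.ker (Phi k n)
    rw [TwoSidedIdeal.mem_ker, map_smul, Phi_eq_zero_iff.2 (matrixRep_e h), smul_zero]

theorem ker_PhiHalf (hn : 1 ≤ n) (h : n + 1 < 2 * k) :
    TwoSidedIdeal.ker (PhiHalf k n) = TwoSidedIdeal.span {(c k n)⁻¹ • eHalf k n h} := by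
  refine le_antisymm (fun a ha => ?_) (TwoSidedIdeal.span_le.2 ?_)
  · rw [TwoSidedIdeal.mem_ker, PhiHalf_eq_zero_iff (by omega) hn] at ha
    let J := TwoSidedIdeal.span {(c k n)⁻¹ • eHalf k n h}
    let I : Submodule ℂ (PartitionAlgebra k (n : ℂ)) :=
      { carrier := {x | ∃ y ∈ J, y.1 = x}
        add_mem' := by
          rintro _ _ ⟨x, hx, rfl⟩ ⟨y, hy, rfl⟩
          exact ⟨x + y, J.add_mem hx hy, rfl⟩
        zero_mem' := ⟨0, J.zero_mem, rfl⟩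
        smul_mem' := by
          rintro r _ ⟨x, hx, rfl⟩
          refine ⟨r • x, ?_, rfl⟩
          rw [Algebra.smul_def]
          exact J.mul_mem_left _ _ hx }
    have he : eHalf k n h ∈ J := mem_span_inv_smul (eHalf k n h) (c_ne_zero (k := k) (n := n))
    have hI : ∀ x, x ∈ I ↔ ∃ y ∈ J, y.1 = x := fun _ => Iff.rfl
    have hleft : ∀ α : SetPartition k, (True → α.LastConnected) → ∀ x ∈ I,
        diagram (n : ℂ) α * x ∈ I := by
      intro α hα x hx
      rw [hI] at hx ⊢
      obtain ⟨y, hy, rfl⟩ := hx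
      let z : half k (n : ℂ) := ⟨diagram (n : ℂ) α, diagram_mem_half (hα trivial)⟩
      exact ⟨z * y, J.mul_mem_left z y hy, rfl⟩
    have hright : ∀ α : SetPartition k, (True → α.LastConnected) → ∀ x ∈ I,
        x * diagram (n : ℂ) α ∈ I := by
      intro α hα x hx
      rw [hI] at hx ⊢
      obtain ⟨y, hy, rfl⟩ := hx
      let z : half k (n : ℂ) := ⟨diagram (n : ℂ) α, diagram_mem_half (hα trivial)⟩
      exact ⟨y * z, J.mul_mem_right y z hy, rfl⟩
    have hJ := orbit_mem_of_e_mem (by omega) (fun _ => h) ((hI _).2 ⟨_, he, rfl⟩) hleft hright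
    obtain ⟨b, hb, hba⟩ := mem_of_matrixRep_eq_zero (Q := LastConnected)
      (fun π ρ hle hπ i hi => hle (hπ i hi)) (fun δ hQ hδ => hJ δ (fun _ => hQ) hδ) a.2 ha
    obtain rfl : b = a := Subtype.ext hba
    exact hb
  · rw [Set.singleton_subset_iff]
    change _ ∈ TwoSidedIdeal.ker (PhiHalf k n)
    have h0 : matrixRep k n (eHalf k n h).1 = 0 := matrixRep_e (k := k) (n := n) (by omega)
    rw [TwoSidedIdeal.mem_ker, map_smul, (PhiHalf_eq_zero_iff (by omega) hn).2 h0, smul_zero]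

end PartitionAlgebra
end

theorem theorem5p7 (k n : ℕ) (hk : 1 ≤ k) (hn : 1 ≤ n) (h : n < 2 * k) :
    (PartitionAlgebra.e k n ≠ 0 ∧ PartitionAlgebra.c k n ≠ 0 ∧
      PartitionAlgebra.e k n ^ 2 = PartitionAlgebra.c k n • PartitionAlgebra.e k n) ∧
    (IsIdempotentElem ((PartitionAlgebra.c k n)⁻¹ • PartitionAlgebra.e k n) ∧
      TwoSidedIdeal.ker (PartitionAlgebra.Phi k n) =
        TwoSidedIdeal.span {(PartitionAlgebra.c k n)⁻¹ • PartitionAlgebra.e k n}) ∧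
    (∀ h' : n + 1 < 2 * k,
      IsIdempotentElem ((PartitionAlgebra.c k n)⁻¹ • PartitionAlgebra.eHalf k n h') ∧
      TwoSidedIdeal.ker (PartitionAlgebra.PhiHalf k n) =
        TwoSidedIdeal.span {(PartitionAlgebra.c k n)⁻¹ • PartitionAlgebra.eHalf k n h'}) := by
  have hsq := PartitionAlgebra.e_mul_self h
  have hc : PartitionAlgebra.c k n ≠ 0 := PartitionAlgebra.c_ne_zero
  exact ⟨⟨PartitionAlgebra.orbit_ne_zero _ _, hc, (sq _).trans hsq⟩,
    ⟨PartitionAlgebra.isIdempotentElem_inv_smul hc hsq, PartitionAlgebra.ker_Phi h⟩,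
    fun h' => ⟨PartitionAlgebra.isIdempotentElem_inv_smul hc (Subtype.ext hsq),
      PartitionAlgebra.ker_PhiHalf hn h'⟩⟩
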